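/- Let $n\ge 1$ and let $\Sigma_n=\{a_1,a_1^{-1},\dots,a_n,a_n^{-1}\}$, an alphabet of $2n$ letters. For $p=(p_1,\dots,p_n)\in\mathbb Z^n$ parametrise the straight line from $0$ to $p$ by $x_i(t)=p_i t$ $(1\le i\le n)$, $0\le t\le 1$. As $t$ increases from $0$ to $1$, each time some $x_i$ assumes a positive integer value write down $a_i$, and each time some $x_i$ assumes a negative integer value write down $a_i^{-1}$; if several $x_i$ assume nonzero integer values at the same time, write down the corresponding letters in order of decreasing $i$. This gives a word in $\Sigma_n^*$, the combing word of $p$ (the empty word if $p=0$). Let $L_n\subseteq\Sigma_n^*$ be the set of the combing words of all $p\in\mathbb Z^n$. A deterministic real-time Turing machine has a finite set of states, an input tape, and a fixed finite number of work tapes, infinite in both directions and initially blank, over a finite alphabet. With each transition it reads one input symbol and moves on to the next one; depending on its state, this input symbol and the symbols scanned on the work tapes, it changes its state, writes a symbol or a blank on the scanned square of each work tape, and then lets each work head stay still or move one square to the left or right. It halts when it reaches the end of the input, and accepts if its state is then an accepting one. A language is a real-time language if it is the set of input words accepted by such a machine. **Theorem.** For every $n\ge 1$, the language $L_n$ is a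 real-time language. -/

import Mathlib

/-! ### Deterministic real-time multitape Turing machines -/

/-- A deterministic real-time Turing machine over the input alphabet `α`. It has finitely many
states, a finite work alphabet (whose `default` symbol is the blank) and a fixed number `tapes` of
two-way infinite work tapes, in addition to the one-way read-only input tape. The transition
function takes the current state, the current input symbol and the symbols scanned on the work
tapes; it yields the new state and, for each work tape, the symbol to write on the scanned square
together with a move (`none` means that the head stays where it is). -/
structure RealTimeTM (α : Type) where
  State : Type
  Symbol : Type
  tapes : ℕ
  [finiteState : Finite State]
  [finiteSymbol : Finite Symbol]
  [inhabitedSymbol : Inhabited Symbol]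
  start : State
  accept : Set State
  transition : State → α → (Fin tapes → Symbol) → State × (Fin tapes → Symbol × Option Turing.Dir)

namespace RealTimeTM

variable {α : Type} (M : RealTimeTM α)

instance : Inhabited M.Symbol := M.inhabitedSymbol

/-- A configuration: the current state, and the contents of the work tapes with their heads.
(The input tape needs no record: the head on it advances by one square with each transition.) -/
structure Cfg where
  state : M.State
  tape : Fin M.tapes → Turing.Tape M.Symbol

/-- The initial configuration: start state, all work tapes blank. -/
def init : M.Cfg where
  state := M.start
  tape := fun _ => default

/-- Moving a head one square to the left or to the right, or not at all. -/
def moveHead (d : Option Turing.Dir) (T : Turing.Tape M.Symbol) : Turing.Tape M.Symbol :=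
  match d with
  | none => T
  | some d => T.move d

/-- One transition, which consumes the input symbol `a`. -/
def step (c : M.Cfg) (a : α) : M.Cfg :=
  let r := M.transition c.state a (fun k => (c.tape k).head)
  { state := r.1
    tape := fun k => M.moveHead (r.2 k).2 ((c.tape k).write (r.2 k).1) }

/-- The configuration in which the machine halts, having made exactly one transition for each
symbol of the input `w`. -/
def run (w : List α) : M.Cfg :=
  w.foldl M.step M.init

/-- The language accepted by the machine: the inputs after which it halts in an accepting state. -/
def accepts : Language α :=
  {w | (M.run w).state ∈ M.accept}

end RealTimeTM

/-- A real-time language: one accepted by a deterministic real-time Turing machine. -/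
def IsRealTimeLanguage {α : Type} (L : Language α) : Prop :=
  ∃ M : RealTimeTM α, M.accepts = L

/-! ### The straight-line combing of `ℤⁿ` -/

namespace StraightLine

/-- The alphabet `Σₙ = {a₁, a₁⁻¹, …, aₙ, aₙ⁻¹}`: `(i, true)` is the letter `aᵢ` and `(i, false)` is
the letter `aᵢ⁻¹`. -/
abbrev Letter (n : ℕ) : Type := Fin n × Bool

variable {n : ℕ}

/-- At time `t ∈ [0, 1]` the `i`-th coordinate `xᵢ = pᵢ t` of the point moving along the straight
line from `0` to `p` assumes a positive or a negative integer value. -/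
def IsCrossing (p : Fin n → ℤ) (t : ℝ) (i : Fin n) : Prop :=
  0 ≤ t ∧ t ≤ 1 ∧ ∃ m : ℤ, m ≠ 0 ∧ (p i : ℝ) * t = m

/-- The crossings of `p`, as a set of pairs `(t, i)`. Pairs are ordered by increasing time `t` and,
for equal times, by decreasing index `i`. -/
def crossingSet (p : Fin n → ℤ) : Set (ℝ ×ₗ (Fin n)ᵒᵈ) :=
  {e | IsCrossing p (ofLex e).1 (OrderDual.ofDual (ofLex e).2)}

theorem finite_crossingSet (p : Fin n → ℤ) : (crossingSet p).Finite := by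
  refine Set.Finite.subset (Set.finite_iUnion fun i : Fin n =>
    (Set.finite_Icc (-|p i|) |p i|).image fun m : ℤ =>
      (toLex ((m : ℝ) / (p i : ℝ), OrderDual.toDual i) : ℝ ×ₗ (Fin n)ᵒᵈ)) ?_
  rintro e ⟨h0, h1, m, hm, he⟩
  refine Set.mem_iUnion.2 ⟨OrderDual.ofDual (ofLex e).2, m, ?_, ?_⟩
  · rw [← abs_le.trans Set.mem_Icc.symm]
    have : |(m : ℝ)| ≤ |(p (OrderDual.ofDual (ofLex e).2) : ℝ)| := by
      rw [← he, abs_mul, abs_of_nonneg h0]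
      exact mul_le_of_le_one_right (abs_nonneg _) h1
    exact_mod_cast this
  · have hp : (p (OrderDual.ofDual (ofLex e).2) : ℝ) ≠ 0 := by
      intro h
      rw [h, zero_mul] at he
      exact hm (by exact_mod_cast he.symm)
    have ht : (m : ℝ) / (p (OrderDual.ofDual (ofLex e).2) : ℝ) = (ofLex e).1 := by
      rw [← he, mul_div_cancel_left₀ _ hp]
    simp only [ht]
    rfl

/-- The crossings of `p` in the order in which their letters are written down. -/
noncomputable def crossings (p : Fin n → ℤ) : List (ℝ ×ₗ (Fin n)ᵒᵈ) :=
  (finite_crossingSet p).toFinset.sort (· ≤ ·)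

/-- The letter written down when `xᵢ = pᵢ t` assumes an integer value: `aᵢ` if that value is
positive, `aᵢ⁻¹` if it is negative. -/
noncomputable def letter (p : Fin n → ℤ) (t : ℝ) (i : Fin n) : Letter n :=
  if 0 < (p i : ℝ) * t then (i, true) else (i, false)

/-- The combing word of the point `p = ∑ pᵢ eᵢ` of `ℤⁿ`. -/
noncomputable def word (p : Fin n → ℤ) : List (Letter n) :=
  (crossings p).map fun e => letter p (ofLex e).1 (OrderDual.ofDual (ofLex e).2)

/-- The language `Lₙ ⊆ Σₙ*` of all combing words of points of `ℤⁿ`. -/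
def combing (n : ℕ) : Language (Letter n) :=
  {w | ∃ p : Fin n → ℤ, w = word p}

end StraightLine

/-!
The theorem is reduced to two coordinates. Ordered by time, the crossings of `p` are the fractions
`s / |pᵢ|` with `1 ≤ s ≤ |pᵢ|`, and their order is determined by comparing them in pairs. Hence
`w` is a combing word if and only if no letter occurs in it together with its inverse and the
projection of `w` to any two coordinates `i < j`, which is written as a word in `false` and
`true`, is a cutting word (`mem_combing_iff`): if `A` and `B` are its numbers of letters, then the
next letter after `x - 1` letters `false` and `y - 1` letters `true` is `true` exactly if `y / B ≤
x / A`. Real-time machines can be run in parallel and can ignore letters, so that it suffices to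
recognise the cutting words (`mem_accepts_pairMachine`).

The vector `(A, B)` is known only at the end of the input. While reading a word, the slopes that
are compatible with it form a half-open interval, the cone `[l, r)` of a unimodular pair of
primitive vectors of length `|l|` and `|r|` (sums of coordinates), and all these slopes have the
same cutting word up to length `|l| + |r| - 2`. This word is the central word `mediant u v =
u·ba·v = v·ab·u` of `l + r`, where `a = false`, `b = true`, and the palindromes `u` and `v` are
the central words of `l` and `r` (`ChristoffelPair`). Then comes an event: the letters `ba` if the
slope is at least that of `l + r`, and `ab` otherwise. In the first case `l + r` takes the place
of `l` and the letters up to the next event are those of `v`; in the second case `l + r` takes the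
place of `r` and the letters are those of `u`. So a machine with `u` and `v` on two tapes reads
one of them while it appends the event and the letters read to the other one. No time is lost in
rewinding: as the words are palindromes, a head only has to turn around at the end of its tape.
For this reason the machines are described by tapes with a direction of travel (`ZigzagMachine`).

A word that is compatible with some slope is shorter than `|l| + |r|`, so it is a cutting word if
and only if its endpoint lies on the ray of `l`, that is, if `|l|` divides its length
(`RunInv.isCuttingWord_iff`). This is decided by two unary clocks, see `Mode`.
-/

/-! ### Zigzag machines -/

/-- The operations on a zigzag tape: do nothing, overwrite the scanned square and advance, or
reverse the direction of travel. -/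
inductive ZigzagOp
  | stay
  | push (x : Bool)
  | turn

/-- A zigzag tape is a tape whose head has a direction of travel. It is recorded as the pair of the
squares behind the head (nearest first) and the squares ahead of it, the first of which is scanned;
a missing square is blank. When the head turns, it steps back by one square, so that the two lists
just change places. -/
def ZigzagOp.apply : ZigzagOp → List Bool × List Bool → List Bool × List Bool
  | stay, z => z
  | push x, z => (x :: z.1, z.2.tail)
  | turn, z => (z.2, z.1)

/-- A real-time machine with finitely many zigzag tapes. Unlike a Turing machine, it is not aware
of left and right. -/
structure ZigzagMachine (α : Type) where
  State : Type
  Tape : Type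
  [finiteState : Finite State]
  [finiteTape : Finite Tape]
  start : State
  accept : Set State
  transition : State → α → (Tape → Option Bool) → State × (Tape → ZigzagOp)

namespace ZigzagMachine

attribute [instance] finiteState finiteTape

variable {α β κ : Type}

/-- One transition, on a configuration that consists of the state and the contents of the tapes. -/
def step (M : ZigzagMachine α) (c : M.State × (M.Tape → List Bool × List Bool)) (a : α) :
    M.State × (M.Tape → List Bool × List Bool) :=
  let r := M.transition c.1 a fun k => (c.2 k).2.head?
  (r.1, fun k => (r.2 k).apply (c.2 k))

/-- The configuration after reading the input `w`. -/
def run (M : ZigzagMachine α) (w : List α) : M.State × (M.Tape → List Bool × List Bool) :=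
  w.foldl M.step (M.start, fun _ => ([], []))

/-- The language accepted by a zigzag machine. -/
def accepts (M : ZigzagMachine α) : Language α :=
  {w | (M.run w).1 ∈ M.accept}

theorem run_append_singleton (M : ZigzagMachine α) (w : List α) (a : α) :
    M.run (w ++ [a]) = M.step (M.run w) a := by
  simp [run]

/-! ### Simulation by Turing machines -/

/-- The tape `T` holds the zigzag tape `z`, the direction of travel being to the right if `d` is
true and to the left otherwise. -/
def Holds (d : Bool) (T : Turing.Tape (Option Bool)) (z : List Bool × List Bool) : Prop :=
  ∀ i : ℕ, T.nth (if d then (i : ℤ) else -i) = z.2[i]? ∧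
    T.nth (if d then -(i + 1 : ℤ) else i + 1) = z.1[i]?

theorem Holds.head {d : Bool} {T : Turing.Tape (Option Bool)} {z : List Bool × List Bool}
    (h : Holds d T z) : T.head = z.2.head? := by
  have := (h 0).1
  rw [List.head?_eq_getElem?, ← this, ← Turing.Tape.nth_zero]
  cases d <;> simp

theorem Holds.push {d : Bool} {T : Turing.Tape (Option Bool)} {z : List Bool × List Bool}
    (h : Holds d T z) (x : Bool) :
    Holds d ((T.write (some x)).move (if d then .right else .left))
      ((ZigzagOp.push x).apply z) := by
  intro i
  have h1 := (h (i + 1)).1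
  constructor
  · cases d
    · simp only [Bool.false_eq_true, if_false, Turing.Tape.move_left_nth, Turing.Tape.write_nth,
        ZigzagOp.apply, List.getElem?_tail] at h1 ⊢
      rw [if_neg (by omega), ← h1]
      congr 1
      push_cast
      ring
    · simp only [if_true, Turing.Tape.move_right_nth, Turing.Tape.write_nth,
        ZigzagOp.apply, List.getElem?_tail] at h1 ⊢
      rw [if_neg (by omega), ← h1]
      congr 1
  · rcases i with _ | i
    · cases d <;> simp [ZigzagOp.apply] <;> rfl
    · have h2 := (h i).2
      cases d
      · simp only [Bool.false_eq_true, if_false, Turing.Tape.move_left_nth, Turing.Tape.write_nth,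
          ZigzagOp.apply, List.getElem?_cons_succ] at h2 ⊢
        rw [if_neg (by omega), ← h2]
        congr 1
        push_cast
        ring
      · simp only [if_true, Turing.Tape.move_right_nth, Turing.Tape.write_nth,
          ZigzagOp.apply, List.getElem?_cons_succ] at h2 ⊢
        rw [if_neg (by omega), ← h2]
        congr 1

theorem Holds.turn {d : Bool} {T : Turing.Tape (Option Bool)} {z : List Bool × List Bool}
    (h : Holds d T z) :
    Holds (!d) (T.move (if d then .left else .right)) (ZigzagOp.turn.apply z) := by
  intro i
  obtain ⟨h1, h2⟩ := h i
  cases d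
  · simp only [Bool.false_eq_true, if_false, Bool.not_false, if_true, Turing.Tape.move_right_nth,
      ZigzagOp.apply] at h1 h2 ⊢
    rw [← h1, ← h2]
    exact ⟨rfl, by congr 1; ring⟩
  · simp only [Bool.false_eq_true, if_false, Bool.not_true, if_true, Turing.Tape.move_left_nth,
      ZigzagOp.apply] at h1 h2 ⊢
    rw [← h1, ← h2]
    exact ⟨by congr 1; ring, by congr 1; ring⟩

/-- The action of a zigzag operation on a tape with direction of travel `d` that scans `x`: the new
direction, the symbol to write, and the move. -/
def opAction (d : Bool) (x : Option Bool) : ZigzagOp → Bool × Option Bool × Option Turing.Dir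
  | .stay => (d, x, none)
  | .push y => (d, some y, some (if d then .right else .left))
  | .turn => (!d, x, some (if d then .left else .right))

/-- The Turing machine that simulates a zigzag machine, keeping the directions of travel in its
state. -/
noncomputable def toRealTimeTM (M : ZigzagMachine α) : RealTimeTM α :=
  { State := M.State × (M.Tape → Bool)
    Symbol := Option Bool
    tapes := Nat.card M.Tape
    start := (M.start, fun _ => true)
    accept := {s | s.1 ∈ M.accept}
    transition := fun s a x =>
      let e := Finite.equivFin M.Tape
      let r := M.transition s.1 a fun k => x (e k)
      ((r.1, fun k => (opAction (s.2 k) (x (e k)) (r.2 k)).1),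
        fun i => (opAction (s.2 (e.symm i)) (x i) (r.2 (e.symm i))).2) }

theorem holds_run (M : ZigzagMachine α) (w : List α) :
    ((M.toRealTimeTM.run w).state.1 = (M.run w).1) ∧
    ∀ k : M.Tape, Holds ((M.toRealTimeTM.run w).state.2 k)
      ((M.toRealTimeTM.run w).tape (Finite.equivFin M.Tape k)) ((M.run w).2 k) := by
  induction w using List.reverseRecOn with
  | nil =>
    refine ⟨rfl, fun k i => ?_⟩
    have hn : ∀ z : ℤ, (default : Turing.Tape (Option Bool)).nth z = none := by
      intro z
      rcases z with (_ | n) | n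
      · rfl
      · exact Turing.ListBlank.nth_mk [] n
      · exact Turing.ListBlank.nth_mk [] n
    exact ⟨hn _, hn _⟩
  | append_singleton w a ih =>
    obtain ⟨h1, h2⟩ := ih
    have hr : M.toRealTimeTM.run (w ++ [a]) =
        M.toRealTimeTM.step (M.toRealTimeTM.run w) a := by
      simp [RealTimeTM.run]
    rw [hr, run_append_singleton]
    have hx : (fun k => ((M.toRealTimeTM.run w).tape (Finite.equivFin M.Tape k)).head) =
        fun k => ((M.run w).2 k).2.head? := by
      funext k
      exact (h2 k).head
    have ht : M.transition (M.toRealTimeTM.run w).state.1 a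
        (fun k => ((M.toRealTimeTM.run w).tape (Finite.equivFin M.Tape k)).head) =
        M.transition (M.run w).1 a fun k => ((M.run w).2 k).2.head? := by
      rw [h1, hx]
    refine ⟨congrArg Prod.fst ht, fun k => ?_⟩
    have h3 := h2 k
    have ht2 : (M.transition (M.toRealTimeTM.run w).state.1 a
        (fun k => ((M.toRealTimeTM.run w).tape (Finite.equivFin M.Tape k)).head)).2 k =
        (M.transition (M.run w).1 a fun k => ((M.run w).2 k).2.head?).2 k := by
      rw [ht]
    set c := M.toRealTimeTM.run w
    change Holds (opAction (c.state.2 k) (c.tape (Finite.equivFin M.Tape k)).head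
        ((M.transition c.state.1 a fun k => (c.tape (Finite.equivFin M.Tape k)).head).2 k)).1
      (M.toRealTimeTM.moveHead (opAction
        (c.state.2 ((Finite.equivFin M.Tape).symm (Finite.equivFin M.Tape k)))
        (c.tape (Finite.equivFin M.Tape k)).head
        ((M.transition c.state.1 a fun k => (c.tape (Finite.equivFin M.Tape k)).head).2
          ((Finite.equivFin M.Tape).symm (Finite.equivFin M.Tape k)))).2.2
        ((c.tape (Finite.equivFin M.Tape k)).write (opAction
          (c.state.2 ((Finite.equivFin M.Tape).symm (Finite.equivFin M.Tape k)))
          (c.tape (Finite.equivFin M.Tape k)).head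
          ((M.transition c.state.1 a fun k => (c.tape (Finite.equivFin M.Tape k)).head).2
            ((Finite.equivFin M.Tape).symm (Finite.equivFin M.Tape k)))).2.1))
      (((M.transition (M.run w).1 a fun k => ((M.run w).2 k).2.head?).2 k).apply ((M.run w).2 k))
    rw [Equiv.symm_apply_apply, ht2]
    generalize (M.transition (M.run w).1 a fun k => ((M.run w).2 k).2.head?).2 k = op
    cases op with
    | stay =>
      simp only [opAction, RealTimeTM.moveHead, ZigzagOp.apply]
      exact (Turing.Tape.write_self (c.tape (Finite.equivFin M.Tape k))).symm ▸ h3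
    | push x => exact h3.push x
    | turn =>
      have := h3.turn
      simp only [opAction, RealTimeTM.moveHead]
      exact (Turing.Tape.write_self (c.tape (Finite.equivFin M.Tape k))).symm ▸ this

theorem isRealTimeLanguage (M : ZigzagMachine α) : IsRealTimeLanguage M.accepts := by
  refine ⟨M.toRealTimeTM, ?_⟩
  ext w
  change (M.toRealTimeTM.run w).state.1 ∈ M.accept ↔ (M.run w).1 ∈ M.accept
  rw [(M.holds_run w).1]

/-! ### Closure properties -/

/-- The machine that runs finitely many machines in parallel and accepts if all of them do. -/
def inter [Finite κ] (M : κ → ZigzagMachine α) : ZigzagMachine α :=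
  { State := ∀ k, (M k).State
    Tape := Σ k, (M k).Tape
    start := fun k => (M k).start
    accept := {s | ∀ k, s k ∈ (M k).accept}
    transition := fun s a x =>
      (fun k => ((M k).transition (s k) a fun t => x ⟨k, t⟩).1,
        fun t => ((M t.1).transition (s t.1) a fun t' => x ⟨t.1, t'⟩).2 t.2) }

theorem mem_accepts_inter [Finite κ] (M : κ → ZigzagMachine α) (w : List α) :
    w ∈ (inter M).accepts ↔ ∀ k, w ∈ (M k).accepts := by
  have h : (∀ k, ((inter M).run w).1 k = ((M k).run w).1) ∧
      ∀ k t, ((inter M).run w).2 ⟨k, t⟩ = ((M k).run w).2 t := by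
    induction w using List.reverseRecOn with
    | nil => exact ⟨fun _ => rfl, fun _ _ => rfl⟩
    | append_singleton w a ih =>
      simp only [run_append_singleton]
      have ht : ∀ k, (M k).transition (((inter M).run w).1 k) a
            (fun t => (((inter M).run w).2 ⟨k, t⟩).2.head?) =
          (M k).transition ((M k).run w).1 a fun t => (((M k).run w).2 t).2.head? := by
        intro k
        simp only [ih.1 k, ih.2 k]
      refine ⟨fun k => congrArg Prod.fst (ht k), fun k t => ?_⟩
      change ZigzagOp.apply (((M k).transition (((inter M).run w).1 k) a
          fun t => (((inter M).run w).2 ⟨k, t⟩).2.head?).2 t) (((inter M).run w).2 ⟨k, t⟩) = _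
      rw [ht k, ih.2 k t]
      rfl
  change (∀ k, ((inter M).run w).1 k ∈ (M k).accept) ↔ ∀ k, ((M k).run w).1 ∈ (M k).accept
  simp only [h.1]

/-- The machine that translates or ignores the input letters as told by `f`. -/
def comap (f : α → Option β) (M : ZigzagMachine β) : ZigzagMachine α :=
  { State := M.State
    Tape := M.Tape
    start := M.start
    accept := M.accept
    transition := fun s a x =>
      (f a).elim (s, fun _ => .stay) fun b => M.transition s b x }

theorem mem_accepts_comap (f : α → Option β) (M : ZigzagMachine β) (w : List α) :
    w ∈ (comap f M).accepts ↔ w.filterMap f ∈ M.accepts := by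
  have h : (comap f M).run w = M.run (w.filterMap f) := by
    induction w using List.reverseRecOn with
    | nil => rfl
    | append_singleton w a ih =>
      rw [run_append_singleton, List.filterMap_append, ih]
      cases hf : f a with
      | none =>
        simp only [List.filterMap_cons, hf, List.filterMap_nil, List.append_nil]
        simp only [step, comap, hf, Option.elim_none, ZigzagOp.apply]
      | some b =>
        simp only [List.filterMap_cons, hf, List.filterMap_nil, run_append_singleton]
        simp only [step, comap, hf, Option.elim_some]
  change ((comap f M).run w).1 ∈ M.accept ↔ (M.run (w.filterMap f)).1 ∈ M.accept
  rw [h]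
  rfl

end ZigzagMachine

/-! ### Cutting words -/

namespace Cutting

/-- The letters of `w` are chosen by `P`: if the next letter `false` is the `x`-th and the next
letter `true` is the `y`-th, then the next letter is `true` if and only if `P x y` holds. For a
lattice path in which `false` and `true` are the unit steps in the first and in the second
coordinate, `(x, y)` is the corner opposite to the current position in the next unit square, so that
a path from the origin starts with `x = y = 1`. -/
def Follows (P : ℕ → ℕ → Prop) : ℕ → ℕ → List Bool → Prop
  | _, _, [] => True
  | x, y, c :: w =>
    (c = true ↔ P x y) ∧ Follows P (if c then x else x + 1) (if c then y + 1 else y) w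

/-- The point `(x, y)` lies on the ray through `(A, B)` or below it. When a point moves along this
ray, its second coordinate becomes `y` not later than its first coordinate becomes `x`. -/
def Below (A B x y : ℕ) : Prop := y * A ≤ x * B

/-- The point `(x, y)` lies strictly below the ray through `(A, B)`. -/
def StrictBelow (A B x y : ℕ) : Prop := y * A < x * B

variable {P Q : ℕ → ℕ → Prop} {u v w w' : List Bool} {x y A B : ℕ}

theorem follows_append : Follows P x y (w ++ w') ↔
    Follows P x y w ∧ Follows P (x + w.count false) (y + w.count true) w' := by
  induction w generalizing x y with
  | nil => simp [Follows]
  | cons c w ih =>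
    cases c <;> simp [Follows, ih, and_assoc, add_assoc, add_comm 1]

theorem follows_shift (a b : ℕ) :
    Follows P (x + a) (y + b) w ↔ Follows (fun x y => P (x + a) (y + b)) x y w := by
  induction w generalizing x y with
  | nil => simp [Follows]
  | cons c w ih =>
    have h1 := @ih (x + 1) y
    have h2 := @ih x (y + 1)
    cases c <;> simp_all [Follows, add_right_comm]

theorem follows_congr
    (h : ∀ x' y', x ≤ x' → y ≤ y' → x' + y' < x + y + w.length → (P x' y' ↔ Q x' y')) :
    Follows P x y w ↔ Follows Q x y w := by
  induction w generalizing x y with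
  | nil => simp [Follows]
  | cons c w ih =>
    simp only [Follows]
    rw [h x y le_rfl le_rfl (by simp)]
    refine and_congr_right fun _ => ih fun x' y' h1 h2 h3 => h x' y' ?_ ?_ ?_
    all_goals cases c <;> simp at h1 h2 h3 ⊢ <;> omega

theorem Follows.unique (h : Follows P x y w) (h' : Follows P x y w')
    (hl : w.length = w'.length) : w = w' := by
  induction w generalizing x y w' with
  | nil => simpa [eq_comm] using hl
  | cons c w ih =>
    cases w' with
    | nil => simp at hl
    | cons c' w' =>
      obtain rfl : c = c' := Bool.eq_iff_iff.2 (h.1.trans h'.1.symm)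
      rw [ih h.2 h'.2 (by simpa using hl)]

theorem count_add_count (w : List Bool) : w.count false + w.count true = w.length := by
  exact w.count_false_add_count_true

/-- A path that follows the ray through `(A, B)` stays close to it. -/
theorem Follows.bound (h : Follows (Below A B) x y w)
    (h1 : x * B < y * A + B) (h2 : y * A ≤ x * B + A) :
    (x + w.count false) * B < (y + w.count true) * A + B ∧
      (y + w.count true) * A ≤ (x + w.count false) * B + A := by
  induction w generalizing x y with
  | nil => exact ⟨by simpa using h1, by simpa using h2⟩
  | cons c w ih =>
    cases c with
    | false =>
      have h3 : x * B < y * A := by simpa [Follows, Below] using h.1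
      have := ih (x := x + 1) (y := y) (by simpa using h.2) (by linarith) (by linarith)
      simpa [add_assoc, add_comm 1, add_left_comm 1] using this
    | true =>
      have h3 : y * A ≤ x * B := by simpa [Follows, Below] using h.1
      have := ih (x := x) (y := y + 1) (by simpa using h.2) (by linarith) (by linarith)
      simpa [add_assoc, add_comm 1, add_left_comm 1] using this

/-- A path that follows the ray through `(A, B)` from the origin meets the multiples of `(A, B)`. -/
theorem Follows.count_eq (hA : 0 < A) (hB : 0 < B) (h : Follows (Below A B) 1 1 w) {g : ℕ}
    (hw : w.length = g * (A + B)) : w.count false = g * A ∧ w.count true = g * B := by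
  obtain ⟨h1, h2⟩ := h.bound (by linarith) (by linarith)
  have hl := count_add_count w
  rw [hw] at hl
  zify at h1 h2 hl ⊢
  obtain ⟨e, he⟩ : ∃ e : ℤ, (w.count false : ℤ) = g * A + e := ⟨w.count false - g * A, by ring⟩
  have he' : (w.count true : ℤ) = g * B - e := by linarith
  rw [he, he'] at h1 h2
  have hA' : (0 : ℤ) < A := by exact_mod_cast hA
  have hB' : (0 : ℤ) < B := by exact_mod_cast hB
  have h3 : e * (A + B) < A := by linarith
  have h4 : -(B : ℤ) ≤ e * (A + B) := by linarith
  have : e = 0 := by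
    by_contra h0
    rcases lt_or_gt_of_ne h0 with h0 | h0
    · have : e * (A + B) ≤ -1 * (A + B) := by gcongr; omega
      linarith
    · have : 1 * ((A : ℤ) + B) ≤ e * (A + B) := by gcongr; omega
      linarith
  rw [he, he', this]
  simp

theorem follows_replicate_true (k : ℕ) :
    Follows P x y (List.replicate k true) ↔ ∀ i < k, P x (y + i) := by
  induction k with
  | zero => simp [Follows]
  | succ k ih =>
    rw [List.replicate_succ', follows_append, ih, Nat.forall_lt_succ_right]
    simp [Follows, List.count_replicate]

theorem follows_replicate_false (k : ℕ) :
    Follows P x y (List.replicate k false) ↔ ∀ i < k, ¬ P (x + i) y := by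
  induction k with
  | zero => simp [Follows]
  | succ k ih =>
    rw [List.replicate_succ', follows_append, ih, Nat.forall_lt_succ_right]
    simp [Follows, List.count_replicate]

/-! ### Christoffel pairs -/

/-- The primitive vector attached to a central word `u` is the number of letters of either kind in
the word `u ++ [true, false]`. -/
def vec (u : List Bool) : ℕ × ℕ := (u.count false + 1, u.count true + 1)

/-- The central word of the mediant. -/
def mediant (u v : List Bool) : List Bool := u ++ true :: false :: v

/-- The central words `u` and `v` of two primitive vectors that form a unimodular pair, that of `u`
having the smaller slope. The last three conditions say that `u ++ [true, false]` follows the ray of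
`u`, that `v ++ [false, true]` follows the slopes just below that of `v`, and that the central word
of the mediant follows the ray of `u`. -/
structure ChristoffelPair (u v : List Bool) : Prop where
  reverse_left : u.reverse = u
  reverse_right : v.reverse = v
  comm : mediant u v = v ++ false :: true :: u
  det : (vec u).1 * (vec v).2 = (vec u).2 * (vec v).1 + 1
  left : Follows (Below (vec u).1 (vec u).2) 1 1 (u ++ [true, false])
  right : Follows (StrictBelow (vec v).1 (vec v).2) 1 1 (v ++ [false, true])
  mid : Follows (Below (vec u).1 (vec u).2) 1 1 (mediant u v)

/-- The vector `(A, B)` lies in the cone spanned by the vectors of `u` and `v`, but not on the ray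
of `v`. -/
def InCone (u v : List Bool) (A B : ℕ) : Prop :=
  Below A B (vec u).1 (vec u).2 ∧ ¬ Below A B (vec v).1 (vec v).2

theorem vec_mediant : vec (mediant u v) = vec u + vec v := by
  simp [vec, mediant, Prod.ext_iff]
  omega

theorem vec_sum : (vec u).1 + (vec u).2 = u.length + 2 := by
  have := count_add_count u
  simp [vec]
  omega

theorem length_mediant : (mediant u v).length = u.length + v.length + 2 := by
  simp [mediant]; omega

/-- A vector that is too short to lie inside the cone of a unimodular pair is on the same side of
all vectors of the cone. -/
theorem below_iff_of_inCone (hdet : (vec u).1 * (vec v).2 = (vec u).2 * (vec v).1 + 1)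
    (hs : InCone u v A B) (hx : 0 < x) (hxy : x + y < u.length + v.length + 4) :
    (Below A B x y ↔ Below (vec u).1 (vec u).2 x y) ∧
    (Below (vec u).1 (vec u).2 x y ↔ StrictBelow (vec v).1 (vec v).2 x y) ∧
    (Below (vec u).1 (vec u).2 x y ↔
      StrictBelow ((vec u).1 + (vec v).1) ((vec u).2 + (vec v).2) x y) := by
  have h1 := @vec_sum u
  have h2 := @vec_sum v
  have p1 : 0 < (vec u).1 := by simp [vec]
  have p2 : 0 < (vec u).2 := by simp [vec]
  have p3 : 0 < (vec v).1 := by simp [vec]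
  have p4 : 0 < (vec v).2 := by simp [vec]
  simp only [InCone, Below, StrictBelow, not_le] at hs ⊢
  generalize (vec u).1 = l1 at *
  generalize (vec u).2 = l2 at *
  generalize (vec v).1 = r1 at *
  generalize (vec v).2 = r2 at *
  have hxy : x + y < l1 + l2 + (r1 + r2) := by omega
  clear h1 h2
  obtain ⟨hs1, hs2⟩ := hs
  zify at *
  -- coordinates of the two vectors with respect to the basis
  obtain ⟨a, ha⟩ : ∃ a : ℤ, a = x * r2 - y * r1 := ⟨_, rfl⟩
  obtain ⟨b, hb⟩ : ∃ b : ℤ, b = l1 * y - l2 * x := ⟨_, rfl⟩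
  obtain ⟨σ, hσ⟩ : ∃ σ : ℤ, σ = A * r2 - B * r1 := ⟨_, rfl⟩
  obtain ⟨τ, hτ⟩ : ∃ τ : ℤ, τ = l1 * B - l2 * A := ⟨_, rfl⟩
  have e1 : (x : ℤ) = a * l1 + b * r1 := by rw [ha, hb]; linear_combination (-(x : ℤ)) * hdet
  have e2 : (y : ℤ) = a * l2 + b * r2 := by rw [ha, hb]; linear_combination (-(y : ℤ)) * hdet
  have e3 : (x : ℤ) * B - y * A = a * τ - b * σ := by
    rw [ha, hb, hσ, hτ]; linear_combination (-((x : ℤ) * B - y * A)) * hdet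
  have hσ' : 0 < σ := by linarith
  have hτ' : 0 ≤ τ := by linarith
  have hab : ¬ (0 < a ∧ 0 < b) := by
    rintro ⟨h1, h2⟩
    have := mul_nonneg (show 0 ≤ a - 1 by omega) (show 0 ≤ (l1 : ℤ) + l2 by omega)
    have := mul_nonneg (show 0 ≤ b - 1 by omega) (show 0 ≤ (r1 : ℤ) + r2 by omega)
    linarith
  have hab' : ¬ (a ≤ 0 ∧ b ≤ 0) := by
    rintro ⟨h1, h2⟩
    have := mul_nonpos_of_nonpos_of_nonneg h1 p1.le
    have := mul_nonpos_of_nonpos_of_nonneg h2 p3.le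
    linarith
  by_cases h : 0 < a
  · have h' : b ≤ 0 := by by_contra h'; exact hab ⟨h, by omega⟩
    have h3 : 0 ≤ a * τ := mul_nonneg h.le hτ'
    have h4 : b * σ ≤ 0 := mul_nonpos_of_nonpos_of_nonneg h' hσ'.le
    have f : (y : ℤ) * l1 ≤ x * l2 := by linarith
    exact ⟨iff_of_true (by linarith) f, iff_of_true f (by linarith), iff_of_true f (by linarith)⟩
  · have h' : 0 < b := by by_contra h'; exact hab' ⟨by omega, by omega⟩
    have h0 : a ≤ 0 := by omega
    have h3 : a * τ ≤ 0 := mul_nonpos_of_nonpos_of_nonneg h0 hτ'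
    have h4 : 0 < b * σ := mul_pos h' hσ'
    have f : ¬ (y : ℤ) * l1 ≤ x * l2 := by linarith
    exact ⟨iff_of_false (by linarith) f, iff_of_false f (by linarith),
      iff_of_false f (by linarith)⟩

namespace ChristoffelPair

variable (h : ChristoffelPair u v)
include h

theorem inCone_left : InCone u v (vec u).1 (vec u).2 := by
  refine ⟨by simp [Below, mul_comm], ?_⟩
  have := h.det
  simp only [Below, not_le]
  linarith [mul_comm (vec v).1 (vec u).2, mul_comm (vec v).2 (vec u).1]

/-- Up to the mediant, all vectors of the cone have the same cutting word. -/
theorem follows_mediant (hs : InCone u v A B) : Follows (Below A B) 1 1 (mediant u v) :=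
  (follows_congr fun x' y' h1 _ h3 => (below_iff_of_inCone h.det hs h1
    (by rw [length_mediant] at h3; omega)).1).2 h.mid

theorem follows_mediant_right :
    Follows (StrictBelow (vec v).1 (vec v).2) 1 1 (mediant u v) :=
  (follows_congr fun x' y' h1 _ h3 => (below_iff_of_inCone h.det h.inCone_left h1
    (by rw [length_mediant] at h3; omega)).2.1).1 h.mid

theorem reverse_mediant : (mediant u v).reverse = mediant u v := by
  conv_rhs => rw [h.comm]
  simp [mediant, h.reverse_left, h.reverse_right]

/-- The pair for the slopes from the mediant on. -/
theorem stepLeft : ChristoffelPair (mediant u v) v where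
  reverse_left := h.reverse_mediant
  reverse_right := h.reverse_right
  comm := by
    rw [mediant, h.comm, ← h.comm]
    nth_rw 1 [h.comm]
    simp [mediant]
  det := by
    have := h.det
    simp only [vec_mediant, Prod.fst_add, Prod.snd_add]
    linarith [mul_comm (vec v).1 (vec v).2, add_mul (vec u).1 (vec v).1 (vec v).2,
      add_mul (vec u).2 (vec v).2 (vec v).1]
  left := by
    have hc : InCone u v (vec (mediant u v)).1 (vec (mediant u v)).2 := by
      have := h.det
      rw [vec_mediant]
      simp only [InCone, Below, Prod.fst_add, Prod.snd_add]
      constructor <;> nlinarith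
    refine follows_append.2 ⟨h.follows_mediant hc, ?_⟩
    simp only [Follows, Below]
    simp [vec, add_comm 1]
    constructor <;> linarith
  right := h.right
  mid := by
    have hh : Follows (StrictBelow (vec v).1 (vec v).2) 1 1 (mediant (mediant u v) v) := by
      -- after a period of `v` the path sees the ray of `v` in the same position as at the origin
      have e : mediant (mediant u v) v = (v ++ [false, true]) ++ mediant u v := by
        conv_lhs => rw [mediant, h.comm]
        simp [mediant]
      rw [e]
      refine follows_append.2 ⟨h.right, ?_⟩
      rw [follows_shift]
      refine (follows_congr fun x' y' _ _ _ => ?_).1 h.follows_mediant_right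
      simp [StrictBelow, vec]
      constructor <;> intro <;> nlinarith
    have hdet : (vec (mediant u v)).1 * (vec v).2 = (vec (mediant u v)).2 * (vec v).1 + 1 := by
      have := h.det
      simp only [vec_mediant, Prod.fst_add, Prod.snd_add]
      nlinarith
    refine (follows_congr fun x' y' h1 _ h3 => (below_iff_of_inCone (u := mediant u v) (v := v)
      (A := (vec (mediant u v)).1) (B := (vec (mediant u v)).2) hdet ⟨?_, ?_⟩ h1 ?_).2.1).2 hh
    · simp [Below, mul_comm]
    · simp only [Below, not_le]; nlinarith
    · rw [length_mediant] at h3; omega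

/-- The pair for the slopes below the mediant. -/
theorem stepRight : ChristoffelPair u (mediant u v) where
  reverse_left := h.reverse_left
  reverse_right := h.reverse_mediant
  comm := by
    conv_lhs => rw [mediant, h.comm]
    simp [mediant]
  det := by
    have := h.det
    simp only [vec_mediant, Prod.fst_add, Prod.snd_add]
    nlinarith
  left := h.left
  right := by
    refine follows_append.2 ⟨(follows_congr fun x' y' h1 _ h3 => ?_).1 h.mid, ?_⟩
    · rw [vec_mediant]
      exact (below_iff_of_inCone h.det h.inCone_left h1
        (by rw [length_mediant] at h3; omega)).2.2
    · simp only [Follows, StrictBelow]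
      simp [vec, add_comm 1]
      constructor <;> linarith
  mid := by
    -- after a period of `u` the path sees the ray of `u` in the same position as at the origin
    have e : mediant u (mediant u v) = (u ++ [true, false]) ++ mediant u v := by
      simp [mediant]
    rw [e]
    refine follows_append.2 ⟨h.left, ?_⟩
    rw [follows_shift]
    refine (follows_congr fun x' y' _ _ _ => ?_).1 h.mid
    simp [Below, vec]
    constructor <;> intro <;> nlinarith

omit h in
theorem replicate_true (k : ℕ) :
    ChristoffelPair (List.replicate k true) (List.replicate (k + 1) true) where
  reverse_left := List.reverse_replicate
  reverse_right := List.reverse_replicate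
  comm := by
    rw [mediant, List.replicate_succ']
    simp
    rw [← List.replicate_succ, List.replicate_succ']
  det := by simp [vec, List.count_replicate]
  left := by
    rw [follows_append, follows_replicate_true]
    simp [vec, List.count_replicate, Follows, Below]
    exact ⟨fun _ _ => by omega, by omega⟩
  right := by
    rw [follows_append, follows_replicate_true]
    simp [vec, List.count_replicate, Follows, StrictBelow]
    exact ⟨fun _ _ => by omega, by omega⟩
  mid := by
    rw [mediant, follows_append, follows_replicate_true]
    simp [Follows, follows_replicate_true, vec, List.count_replicate, Below]
    exact ⟨fun _ _ => by omega, by omega, fun _ _ => by omega⟩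

omit h in
theorem replicate_false (k : ℕ) :
    ChristoffelPair (List.replicate (k + 1) false) (List.replicate k false) where
  reverse_left := List.reverse_replicate
  reverse_right := List.reverse_replicate
  comm := by
    rw [mediant, List.replicate_succ']
    simp
    rw [← List.replicate_succ, List.replicate_succ']
  det := by simp [vec, List.count_replicate]
  left := by
    rw [follows_append, follows_replicate_false]
    simp [vec, List.count_replicate, Follows, Below]
    exact ⟨fun _ _ => by omega, by omega⟩
  right := by
    rw [follows_append, follows_replicate_false]
    simp [vec, List.count_replicate, Follows, StrictBelow]
    exact ⟨fun _ _ => by omega, by omega⟩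
  mid := by
    rw [mediant, follows_append, follows_replicate_false]
    simp [Follows, follows_replicate_false, vec, List.count_replicate, Below]
    exact ⟨fun _ _ => by omega, by omega, fun _ _ => by omega⟩

end ChristoffelPair

end Cutting

namespace Cutting

/-! ### The pair machine -/

/-- The word `w` is the cutting word of the segment from the origin to the point whose coordinates
are the numbers of letters of either kind in `w`. -/
def IsCuttingWord (w : List Bool) : Prop :=
  Follows (Below (w.count false) (w.count true)) 1 1 w

/-- The modes of the two clocks of the pair machine, the timer and the clock proper. Write `l` and
`r` for the lengths of the left and of the right vector of the current cone. During a run of events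
`[true, false]` the left vector grows at each event and both clocks are extended: the clock to
length `l - 1`, and the timer to the corresponding length before the last event. In the mode
`first`, which lasts until the second event of the run, the timer only goes to the end of its tape.
During a run of events `[false, true]` the left vector is constant. At the second letter of the run
(mode `fresh`) the timer turns, and it reaches the end of its tape (`wait`) just when twice the
period `l` is over. From then on the clock goes back and forth with period `l`, while the timer is
extended to length `l - 1` until the next event (`ext`) and then rests (`bounce`). When a new run of
events `[true, false]` begins, the timer has the length that is required of the clock, and the clock
that of the timer. -/
inductive Mode | first | later | fresh | wait | ext | bounce

namespace Mode

/-- The first letter of the event that led to the current mode. -/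
def letter : Mode → Bool
  | first | later => true
  | fresh | wait | ext | bounce => false

/-- The operation of a clock that makes its way to the end of the tape and stays there. -/
def finish (x : Option Bool) : ZigzagOp := if x = none then .stay else .push true

/-- The operation of a clock that goes back and forth. -/
def oscillate (x : Option Bool) : ZigzagOp := if x = none then .turn else .push true

/-- The regular action of the clocks: given the mode and the symbols scanned by the timer and the
clock, it yields the new mode, the operations of the timer and of the clock, and whether the length
of the input read so far is now a multiple of the period. (At the second letter of an event
`[true, false]` it always is, and this is left to the control of the machine.) -/
def tick : Mode → Option Bool → Option Bool → Mode × ZigzagOp × ZigzagOp × Bool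
  | first, t, _ => (first, finish t, .push true, false)
  | later, _, _ => (later, .push true, .push true, false)
  | fresh, _, _ => (wait, .turn, .stay, false)
  | wait, t, _ =>
    if t = none then (ext, .push true, .turn, true) else (wait, .push true, .stay, false)
  | ext, _, x => (ext, .push true, oscillate x, x = none)
  | bounce, _, x => (bounce, .stay, oscillate x, x = none)

/-- The mode after the event letter `false`, given the mode that a regular action leads to. -/
def afterFalse : Mode → Mode
  | first | later => fresh
  | fresh | wait | ext | bounce => bounce

end Mode

/-- The control states of the pair machine. The state `initial c` means that the input so far is
a nonempty power of `c`; in the state `run e m s` the mode is `m`, the boolean `e` tells whether the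
next letter is the second letter of an event, and `s` names the tape that serves as the timer. In
the state `dead` the input is rejected, however it goes on. -/
inductive Control
  | start
  | initial (c : Bool)
  | run (e : Bool) (m : Mode) (s : Bool)
  | dead

instance : Finite Mode :=
  Finite.of_injective (β := Fin 6)
    (fun m => match m with
      | .first => 0 | .later => 1 | .fresh => 2 | .wait => 3 | .ext => 4 | .bounce => 5)
    (by rintro (_ | _) (_ | _) <;> simp)

instance : Finite Control :=
  Finite.of_injective (β := Option (Option (Bool ⊕ Bool × Mode × Bool)))
    (fun c => match c with
      | .start => none | .dead => some none | .initial c => some (some (.inl c))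
      | .run e m s => some (some (.inr (e, m, s))))
    (by rintro (_ | _) (_ | _) <;> simp)

/-- The transitions of the pair machine: given the control state, the input letter and the symbols
scanned on the word tapes and on the clock tapes, it yields the new control state, whether this is
accepting, and the operations on the two kinds of tapes. An event with first letter `c` is appended
to the word tape `!c`. Then the word tape `c` is traversed; the input has to agree with it and is
appended to the word tape `!c` as well. The next event comes at the end of the tape.

The first change of letters, from `c` to `!c`, is treated as the first letter of an event, but it is
not written on a tape: the vectors `(1, 0)` and `(0, 1)` have no central word, and the central word
that the word tape `c` has to hold after this event is the power of `c` that is read next. -/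
def pairTransition (q : Control) (x : Bool) (rw rc : Bool → Option Bool) :
    (Control × Bool) × (Bool → ZigzagOp) × (Bool → ZigzagOp) :=
  match q with
  | .start => ((.initial x, true), fun _ => .stay, fun k => if x && k then .push true else .stay)
  | .initial c =>
    if x = c then
      ((.initial c, true), fun k => if k = c then .stay else .push x,
        fun _ => if x then .push true else .stay)
    else ((.run true (if x then .first else .fresh) false, !x), fun _ => .stay, fun _ => .stay)
  | .dead => ((.dead, false), fun _ => .stay, fun _ => .stay)
  | .run e m s =>
    let r := m.tick (rc s) (rc !s)
    let clocks := fun k => if k = s then r.2.1 else r.2.2.1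
    if e then
      if x = m.letter then ((.dead, false), fun _ => .stay, fun _ => .stay)
      else ((.run false r.1 s, m.letter || r.2.2.2),
        fun k => if k = m.letter then .turn else .push x, clocks)
    else match rw m.letter with
      | some y =>
        if x = y then ((.run false r.1 s, r.2.2.2), fun _ => .push x, clocks)
        else ((.dead, false), fun _ => .stay, fun _ => .stay)
      | none =>
        let words := fun k => if k = x then .stay else .push x
        if x then
          if m.letter then ((.run true .later s, false), words, clocks)
          else ((.run true .first !s, false), words,
            fun k => if k = s then r.2.1 else Mode.finish (rc k))
        else ((.run true r.1.afterFalse s, r.2.2.2), words, clocks)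

/-- The pair machine. Its tapes `inl false` and `inl true` hold the central words of the two sides
of the cone of slopes that are possible for the input read so far, its tapes `inr false` and
`inr true` are unary clocks. -/
def pairMachine : ZigzagMachine Bool where
  State := Control × Bool
  Tape := Bool ⊕ Bool
  start := (.start, true)
  accept := {s | s.2 = true}
  transition s x rd :=
    let r := pairTransition s.1 x (fun k => rd (.inl k)) (fun k => rd (.inr k))
    (r.1, Sum.elim r.2.1 r.2.2)

/-- A step of the pair machine, in terms of its transitions. -/
def pairStep (c : (Control × Bool) × (Bool ⊕ Bool → List Bool × List Bool)) (x : Bool) :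
    (Control × Bool) × (Bool ⊕ Bool → List Bool × List Bool) :=
  let r := pairTransition c.1.1 x (fun k => (c.2 (.inl k)).2.head?)
    (fun k => (c.2 (.inr k)).2.head?)
  (r.1, Sum.elim (fun k => (r.2.1 k).apply (c.2 (.inl k))) fun k => (r.2.2 k).apply (c.2 (.inr k)))

theorem pairMachine_step : pairMachine.step = pairStep := by
  funext c x
  refine Prod.ext rfl (funext ?_)
  rintro (k | k) <;> rfl

/-! ### The clocks -/

/-- What the two clocks contain: the lengths of the parts of the timer `T` and the clock `C`, where
`l` and `r` are the lengths of the vectors of the cone, `N` is the number of letters read so far and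
`e` is the number of letters up to and including the first letter of the next event. -/
def Mode.Inv (T C : List Bool × List Bool) (l r N e : ℕ) : Mode → Prop
  | .first => C.2 = [] ∧ C.1.length + e + 1 = l ∧ T.1.length + T.2.length + r + 1 = l ∧
      T.2.length ≤ e
  | .later => C.2 = [] ∧ C.1.length + e + 1 = l ∧ T.2 = [] ∧ T.1.length + e + r + 1 = l
  | .fresh => C.2 = [] ∧ C.1.length + 1 = l ∧ T.2 = [] ∧ T.1.length + 1 + r = 2 * l ∧ l < r ∧
      e = l
  | .wait => C.2 = [] ∧ C.1.length + 1 = l ∧ T.1.length + e + 1 = l ∧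
      T.1.length + T.2.length + 2 ≤ l ∧ l ∣ N + T.2.length + 1 ∧ l < r
  | .ext => C.1.length + C.2.length + 1 = l ∧ l ∣ N - C.1.length ∧ C.1.length ≤ N ∧ T.2 = [] ∧
      T.1.length + e + 1 = l ∧ l < r
  | .bounce => C.1.length + C.2.length + 1 = l ∧ l ∣ N - C.1.length ∧ C.1.length ≤ N ∧ T.2 = [] ∧
      T.1.length + 1 = l ∧ l < r

/-- The tick of the timer. -/
def Mode.timer (m : Mode) (T C : List Bool × List Bool) : List Bool × List Bool :=
  (m.tick T.2.head? C.2.head?).2.1.apply T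

/-- The tick of the clock. -/
def Mode.clock (m : Mode) (T C : List Bool × List Bool) : List Bool × List Bool :=
  (m.tick T.2.head? C.2.head?).2.2.1.apply C

theorem Mode.letter_tick (m : Mode) (t x : Option Bool) : (m.tick t x).1.letter = m.letter := by
  cases m <;> simp only [tick] <;> try rfl
  split <;> rfl

theorem Mode.tick_ne_fresh (m : Mode) (t x : Option Bool) : (m.tick t x).1 ≠ fresh := by
  cases m <;> simp only [tick] <;> try simp
  split <;> simp

variable {T C : List Bool × List Bool} {l r N e : ℕ} {m : Mode}

theorem Mode.Inv.tick (h : m.Inv T C l r N (e + 1)) (hN : N + (e + 1) + 1 = l + r) :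
    (m.tick T.2.head? C.2.head?).1.Inv (m.timer T C) (m.clock T C) l r (N + 1) e ∧
    (m.letter = true → (m.tick T.2.head? C.2.head?).2.2.2 = false) ∧
    (m.letter = false → ((m.tick T.2.head? C.2.head?).2.2.2 = true ↔ l ∣ N + 1)) := by
  obtain ⟨p, q⟩ := T
  obtain ⟨p', q'⟩ := C
  cases m
  · cases q <;> simp [Inv, Mode.tick, timer, clock, ZigzagOp.apply, finish, letter] at h ⊢ <;>
      simp [h] <;> omega
  · simp [Inv, Mode.tick, timer, clock, ZigzagOp.apply, letter] at h ⊢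
    simp [h]; omega
  · simp [Inv, Mode.tick, timer, clock, ZigzagOp.apply, letter] at h ⊢
    obtain ⟨rfl, h1, rfl, h2, h3, h4⟩ := h
    have h5 : N + 1 + p.length + 1 = 2 * l := by omega
    refine ⟨⟨rfl, h1, by simp; omega, by simp; omega, by rw [h5]; exact Dvd.intro_left 2 rfl, h3⟩,
      fun h => ?_⟩
    have := Nat.le_of_dvd (by omega) (Nat.dvd_sub h (dvd_refl l))
    omega
  · cases q with
    | nil =>
      simp [Inv, Mode.tick, timer, clock, ZigzagOp.apply, letter] at h ⊢
      obtain ⟨rfl, h1, h2, h3, h4, h5⟩ := h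
      simp [h4]
      refine ⟨h1, ?_⟩
      omega
    | cons c q =>
      simp [Inv, Mode.tick, timer, clock, ZigzagOp.apply, letter] at h ⊢
      obtain ⟨rfl, h1, h2, h3, h4, h5⟩ := h
      refine ⟨⟨rfl, h1, by omega, by omega, by convert h4 using 1; ring, h5⟩, fun h => ?_⟩
      have := Nat.le_of_dvd (by omega) ((Nat.dvd_add_right h).1
        (by convert h4 using 1; ring : l ∣ N + 1 + (q.length + 1)))
      omega
  · cases q' with
    | nil =>
      simp [Inv, Mode.tick, timer, clock, ZigzagOp.apply, letter, oscillate] at h ⊢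
      obtain ⟨h1, h2, h3, rfl, h4, h5⟩ := h
      have h6 : l ∣ N + 1 := by
        convert Nat.dvd_add h2 (dvd_refl l) using 1
        omega
      exact ⟨⟨h1, h6, by simp, by omega, h5⟩, h6⟩
    | cons c q' =>
      simp [Inv, Mode.tick, timer, clock, ZigzagOp.apply, letter, oscillate] at h ⊢
      obtain ⟨h1, h2, h3, rfl, h4, h5⟩ := h
      refine ⟨⟨by omega, h2, h3, by simp, by omega, h5⟩, fun h => ?_⟩
      have := Nat.le_of_dvd (by omega) ((Nat.dvd_add_right h2).1
        (by convert h using 1; omega : l ∣ N - p'.length + (p'.length + 1)))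
      omega
  · cases q' with
    | nil =>
      simp [Inv, Mode.tick, timer, clock, ZigzagOp.apply, letter, oscillate] at h ⊢
      obtain ⟨h1, h2, h3, rfl, h4, h5⟩ := h
      have h6 : l ∣ N + 1 := by
        convert Nat.dvd_add h2 (dvd_refl l) using 1
        omega
      exact ⟨⟨h1, h6, by simp, by omega, h5⟩, h6⟩
    | cons c q' =>
      simp [Inv, Mode.tick, timer, clock, ZigzagOp.apply, letter, oscillate] at h ⊢
      obtain ⟨h1, h2, h3, rfl, h4, h5⟩ := h
      refine ⟨⟨by omega, h2, h3, by simp, by omega, h5⟩, fun h => ?_⟩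
      have := Nat.le_of_dvd (by omega) ((Nat.dvd_add_right h2).1
        (by convert h using 1; omega : l ∣ N - p'.length + (p'.length + 1)))
      omega

theorem Mode.Inv.lt (h : m.Inv T C l r N e) (hm : m.letter = true) : r < l := by
  cases m <;> simp [letter, Inv] at h hm <;> omega

theorem Mode.Inv.afterFalse (h : m.Inv T C l r N 0) (hm : m ≠ fresh) (hr : 0 < r) :
    m.afterFalse.Inv T C l (l + r) N l := by
  cases m <;> simp [Mode.afterFalse, Inv] at h hm ⊢ <;> grind

theorem Mode.Inv.later (h : m.Inv T C l r N 0) (hm : m.letter = true) :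
    later.Inv T C (l + r) r N r := by
  cases m <;> simp [letter, Inv] at h hm ⊢ <;> grind

/-- At the end of a run of events `[false, true]` the timer and the clock change places. -/
theorem Mode.Inv.swap (h : m.Inv T C l r N 1) (hm : m.letter = false) (hf : m ≠ fresh) :
    first.Inv ((finish C.2.head?).apply C) (m.timer T C) (l + r) r (N + 1) r := by
  obtain ⟨p, q⟩ := T
  obtain ⟨p', q'⟩ := C
  cases m
  · simp [letter] at hm
  · simp [letter] at hm
  · simp at hf
  all_goals
    cases q' <;> cases q <;>
      simp [letter, Inv, timer, Mode.tick, finish, ZigzagOp.apply] at h hm ⊢ <;> grind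

/-! ### Correctness of the pair machine -/

/-- The two sides of a cone. -/
def side (u v : List Bool) (c : Bool) : List Bool := if c then v else u

/-- The tapes of the pair machine after it has read the input `w` and entered the state
`run e m s`. The word `rest` is the forced continuation of `w` up to the next event. -/
structure RunInv (u v rest w : List Bool) (e : Bool) (m : Mode) (s : Bool)
    (tp : Bool ⊕ Bool → List Bool × List Bool) : Prop where
  pair : ChristoffelPair u v
  append : w ++ rest = mediant u v
  inCone : ∀ A B, Follows (Below A B) 1 1 w → InCone u v A B
  written_ahead : (tp (.inl !m.letter)).2 = []
  written : (tp (.inl !m.letter)).1.reverse ++ rest = side u v !m.letter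
  clocks : m.Inv (tp (.inr s)) (tp (.inr !s)) (u.length + 2) (v.length + 2) w.length
    (rest.length + 1)
  event : e = true → rest = (!m.letter) :: side u v m.letter ∧
    tp (.inl m.letter) = (side u v m.letter, [])
  pass : e = false → m ≠ .fresh ∧ (tp (.inl m.letter)).2 = rest ∧
    (tp (.inl m.letter)).1.reverse ++ rest = side u v m.letter

/-- The invariant of the pair machine. In the state `dead` the input is not a prefix of the cutting
word of any ray. -/
def PairInv (w : List Bool) (c : (Control × Bool) × (Bool ⊕ Bool → List Bool × List Bool)) : Prop :=
  match c.1.1 with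
  | .start => w = [] ∧ c.1.2 = true ∧ ∀ k, c.2 k = ([], [])
  | .initial a => c.1.2 = true ∧ ∃ k, w = List.replicate (k + 1) a ∧
      c.2 (.inl !a) = (List.replicate k a, []) ∧ c.2 (.inl a) = ([], []) ∧
      c.2 (.inr false) = (List.replicate (if a then k else 0) true, []) ∧
      c.2 (.inr true) = (List.replicate (if a then k + 1 else 0) true, [])
  | .dead => c.1.2 = false ∧ ∀ A B, ¬ Follows (Below A B) 1 1 w
  | .run e m s => ∃ u v rest, RunInv u v rest w e m s c.2 ∧ (c.1.2 = true ↔ u.length + 2 ∣ w.length)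

section
variable {u v rest w : List Bool} {s x : Bool} {tp : Bool ⊕ Bool → List Bool × List Bool}

theorem RunInv.length {e : Bool} (h : RunInv u v rest w e m s tp) :
    w.length + rest.length + 2 = u.length + v.length + 4 := by
  have := congrArg List.length h.append
  rw [length_mediant, List.length_append] at this
  omega

theorem RunInv.follows {e : Bool} (h : RunInv u v rest w e m s tp) {A B : ℕ}
    (hw : Follows (Below A B) 1 1 w) : Follows (Below A B) 1 1 (w ++ rest) := by
  rw [h.append]
  exact h.pair.follows_mediant (h.inCone A B hw)

/-- An unexpected letter leaves no possible slope. -/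
theorem RunInv.not_follows {e : Bool} {y : Bool} (h : RunInv u v (y :: rest) w e m s tp)
    (hx : x ≠ y) (A B : ℕ) : ¬ Follows (Below A B) 1 1 (w ++ [x]) := by
  intro hw
  have h1 := follows_append.1 hw
  have h2 := follows_append.1 (h.follows h1.1)
  exact hx (Bool.eq_iff_iff.2 (h1.2.1.trans h2.2.1.symm))

/-- An expected letter: it is moved over on the tape that is read, and copied to the other one. -/
theorem RunInv.letter {e : Bool} {y : Bool} (h : RunInv u v (y :: rest) w e m s tp)
    {tp' : Bool ⊕ Bool → List Bool × List Bool}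
    (ht : tp' (.inr s) = m.timer (tp (.inr s)) (tp (.inr !s)))
    (hc : tp' (.inr !s) = m.clock (tp (.inr s)) (tp (.inr !s)))
    (hw : tp' (.inl !m.letter) = (y :: (tp (.inl !m.letter)).1, []))
    (hr : (tp' (.inl m.letter)).2 = rest)
    (hr' : (tp' (.inl m.letter)).1.reverse ++ rest = side u v m.letter) :
    RunInv u v rest (w ++ [y]) false (m.tick (tp (.inr s)).2.head? (tp (.inr !s)).2.head?).1 s
      tp' where
  pair := h.pair
  append := by rw [← h.append]; simp
  inCone A B hw := h.inCone A B (follows_append.1 hw).1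
  written_ahead := by rw [Mode.letter_tick, hw]
  written := by
    rw [Mode.letter_tick, hw, ← h.written]
    simp
  clocks := by
    rw [ht, hc]
    have := h.length
    have := (Mode.Inv.tick h.clocks (by simp at this ⊢; omega)).1
    simpa using this
  event := by simp
  pass _ := ⟨Mode.tick_ne_fresh _ _ _, by rw [Mode.letter_tick, hr],
    by rw [Mode.letter_tick]; exact hr'⟩

/-- Just before an event, both central words are complete, and as they are palindromes it does not
matter from which end they are read. -/
theorem RunInv.words (h : RunInv u v [] w false m s tp) (k : Bool) :
    tp (.inl k) = (side u v k, []) := by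
  have hs : ∀ k, (side u v k).reverse = side u v k := by
    rintro (_ | _)
    · exact h.pair.reverse_left
    · exact h.pair.reverse_right
  by_cases hk : k = m.letter
  · have := (h.pass rfl).2
    rw [← hk] at this
    refine Prod.ext ?_ this.1
    rw [← hs, ← this.2]
    simp
  · obtain rfl : k = !m.letter := Bool.eq_not.2 hk
    refine Prod.ext ?_ h.written_ahead
    rw [← hs, ← h.written]
    simp

/-- The first letter of an event `[true, false]`: the slope is at least that of the mediant. -/
theorem RunInv.eventTrue (h : RunInv u v [] w false m s tp) {m' : Mode} {s' : Bool}
    {tp' : Bool ⊕ Bool → List Bool × List Bool} (hm : m'.letter = true)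
    (hw : tp' (.inl false) = (true :: u, [])) (hw' : tp' (.inl true) = (v, []))
    (hc : m'.Inv (tp' (.inr s')) (tp' (.inr !s')) (u.length + 2 + (v.length + 2)) (v.length + 2)
      (w.length + 1) (v.length + 2)) :
    RunInv (mediant u v) v (false :: v) (w ++ [true]) true m' s' tp' where
  pair := h.pair.stepLeft
  append := by
    rw [← h.append]
    simp [mediant]
  inCone A B hw := by
    have h1 := follows_append.1 hw
    refine ⟨?_, (h.inCone A B h1.1).2⟩
    have h2 := h1.2.1.1 rfl
    have h3 := h.append
    rw [List.append_nil] at h3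
    rw [h3, add_comm 1, add_comm 1] at h2
    exact h2
  written_ahead := by simp [hm, hw]
  written := by simp [hm, hw, side, h.pair.reverse_left, mediant]
  clocks := by
    rw [length_mediant]
    convert hc using 1
    · omega
    · simp
    · simp
  event _ := by simp [hm, hw', side]
  pass := by simp

/-- The first letter of an event `[false, true]`: the slope is less than that of the mediant. -/
theorem RunInv.eventFalse (h : RunInv u v [] w false m s tp) {m' : Mode} {s' : Bool}
    {tp' : Bool ⊕ Bool → List Bool × List Bool} (hm : m'.letter = false)
    (hw : tp' (.inl true) = (false :: v, [])) (hw' : tp' (.inl false) = (u, []))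
    (hc : m'.Inv (tp' (.inr s')) (tp' (.inr !s')) (u.length + 2) (u.length + 2 + (v.length + 2))
      (w.length + 1) (u.length + 2)) :
    RunInv u (mediant u v) (true :: u) (w ++ [false]) true m' s' tp' where
  pair := h.pair.stepRight
  append := by
    have h3 := h.append
    rw [List.append_nil] at h3
    rw [h.pair.stepRight.comm, h3]
    simp
  inCone A B hw := by
    have h1 := follows_append.1 hw
    refine ⟨(h.inCone A B h1.1).1, ?_⟩
    have h2 := h1.2.1
    have h3 := h.append
    rw [List.append_nil] at h3
    rw [h3, add_comm 1, add_comm 1] at h2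
    simpa [vec] using h2
  written_ahead := by simp [hm, hw]
  written := by simp [hm, hw, side, h.pair.reverse_right, h.pair.comm]
  clocks := by
    rw [length_mediant]
    convert hc using 1
    · omega
    · simp
    · simp
  event _ := by simp [hm, hw', side]
  pass := by simp

/-- As long as some slope is possible, the input is a cutting word if and only if its length is a
multiple of the length of the left vector of the cone. -/
theorem RunInv.isCuttingWord_iff {e : Bool} (h : RunInv u v rest w e m s tp) :
    IsCuttingWord w ↔ u.length + 2 ∣ w.length := by
  have hl := h.length
  have hu := @vec_sum u
  have hv := @vec_sum v
  have hw := count_add_count w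
  constructor
  · intro hc
    have hs := h.inCone _ _ hc
    have hdet := h.pair.det
    simp only [InCone, Below, not_le] at hs
    rw [← hw, ← hu]
    rw [← hw] at hl
    generalize w.count false = A at *
    generalize w.count true = B at *
    generalize (vec u).1 = l1 at *
    generalize (vec u).2 = l2 at *
    generalize (vec v).1 = r1 at *
    generalize (vec v).2 = r2 at *
    have hl' : A + B < l1 + l2 + (r1 + r2) := by omega
    clear hl hu hv hw hc
    zify at *
    -- the coordinates of `(A, B)` in the basis of the two sides of the cone
    obtain ⟨a, ha⟩ : ∃ a : ℤ, a = A * r2 - B * r1 := ⟨_, rfl⟩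
    obtain ⟨b, hb⟩ : ∃ b : ℤ, b = l1 * B - l2 * A := ⟨_, rfl⟩
    have e1 : (A : ℤ) = a * l1 + b * r1 := by
      rw [ha, hb]; linear_combination (-(A : ℤ)) * hdet
    have e2 : (B : ℤ) = a * l2 + b * r2 := by
      rw [ha, hb]; linear_combination (-(B : ℤ)) * hdet
    have ha0 : 0 < a := by linarith
    have hb0 : 0 ≤ b := by linarith
    have hb1 : b = 0 := by
      by_contra h0
      have := mul_nonneg (show 0 ≤ a - 1 by omega) (show 0 ≤ (l1 : ℤ) + l2 by omega)
      have := mul_nonneg (show 0 ≤ b - 1 by omega) (show 0 ≤ (r1 : ℤ) + r2 by omega)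
      linarith
    exact ⟨a, by rw [e1, e2, hb1]; ring⟩
  · rintro ⟨g, hg⟩
    have hf : Follows (Below (vec u).1 (vec u).2) 1 1 w := by
      have := h.pair.follows_mediant h.pair.inCone_left
      rw [← h.append] at this
      exact (follows_append.1 this).1
    obtain ⟨h1, h2⟩ := hf.count_eq (g := g) (by simp [vec]) (by simp [vec])
      (by rw [hg, hu, mul_comm])
    rcases Nat.eq_zero_or_pos g with rfl | hg0
    · have : w = [] := by simpa using hg
      subst this
      simp [IsCuttingWord, Follows]
    · rw [IsCuttingWord, h1, h2]
      refine (follows_congr fun x y _ _ _ => ?_).1 hf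
      simp only [Below]
      rw [mul_left_comm, mul_left_comm x, Nat.mul_le_mul_left_iff hg0]

theorem not_dvd_of_lt {l r N : ℕ} (h1 : 0 < r) (h2 : r < l) (h : N = l + r) : ¬ l ∣ N := by
  rintro hd
  rw [h] at hd
  have := Nat.le_of_dvd h1 ((Nat.dvd_add_right (dvd_refl l)).1 hd)
  omega

theorem PairInv.of_transition {w : List Bool} {q : Control} {acc x : Bool}
    {tp : Bool ⊕ Bool → List Bool × List Bool} {s : Control × Bool} {f g : Bool → ZigzagOp}
    (h : pairTransition q x (fun k => (tp (.inl k)).2.head?) (fun k => (tp (.inr k)).2.head?) =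
      (s, f, g))
    (h' : PairInv w (s, Sum.elim (fun k => (f k).apply (tp (.inl k)))
      fun k => (g k).apply (tp (.inr k)))) : PairInv w (pairStep ((q, acc), tp) x) := by
  rw [pairStep]
  simp only [h]
  exact h'

theorem PairInv.step {w : List Bool}
    {c : (Control × Bool) × (Bool ⊕ Bool → List Bool × List Bool)} (h : PairInv w c) (x : Bool) :
    PairInv (w ++ [x]) (pairStep c x) := by
  obtain ⟨⟨q, acc⟩, tp⟩ := c
  cases q with
  | start =>
    obtain ⟨rfl, -, h⟩ := h
    refine .of_transition rfl ?_
    refine ⟨rfl, 0, rfl, ?_⟩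
    simp only at h
    cases x <;> simp [h, ZigzagOp.apply]
  | initial a =>
    obtain ⟨-, k, rfl, h1, h2, h3, h4⟩ := h
    simp only at h1 h2 h3 h4
    by_cases hx : x = a
    · subst hx
      refine .of_transition (if_pos rfl) ?_
      refine ⟨rfl, k + 1, by rw [← List.replicate_succ'], ?_⟩
      cases x <;> simp_all [ZigzagOp.apply, List.replicate_succ]
    · obtain rfl : a = !x := Bool.eq_not.2 (Ne.symm hx)
      refine .of_transition (if_neg hx) ?_
      simp only [Bool.not_not, ZigzagOp.apply] at h1 h2 h3 h4 ⊢
      -- the cone is spanned by `(1, k + 1)` and `(1, k + 2)` or by `(k + 2, 1)` and `(k + 1, 1)`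
      cases x with
      | false =>
        simp only [Bool.not_false, if_true] at h1 h2 h3 h4 ⊢
        refine ⟨List.replicate k true, List.replicate (k + 1) true,
          true :: List.replicate k true, ⟨?_, ?_, ?_, ?_, ?_, ?_, ?_, ?_⟩, ?_⟩
        · exact ChristoffelPair.replicate_true k
        · simp only [mediant, List.replicate_succ']
          simp
          rw [← List.replicate_succ, List.replicate_succ']
        · intro A B hw
          rw [follows_append, follows_replicate_true] at hw
          have h5 := hw.1 k (by omega)
          simp [Follows, Below, InCone, vec, List.count_replicate] at h5 hw ⊢
          exact ⟨by linarith, by linarith⟩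
        · simp [Mode.letter, h2]
        · simp [Mode.letter, h2, side, List.replicate_succ]
        · simp [Mode.Inv, h3, h4]
          omega
        · simp [Mode.letter, h1, side]
        · simp
        · simp
      | true =>
        simp only [Bool.not_true, Bool.false_eq_true, if_false] at h1 h2 h3 h4 ⊢
        refine ⟨List.replicate (k + 1) false, List.replicate k false,
          false :: List.replicate k false, ⟨?_, ?_, ?_, ?_, ?_, ?_, ?_, ?_⟩, ?_⟩
        · exact ChristoffelPair.replicate_false k
        · simp [mediant, List.replicate_succ']
        · intro A B hw
          rw [follows_append, follows_replicate_false] at hw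
          have h5 := hw.1 k (by omega)
          simp [Follows, Below, InCone, vec, List.count_replicate] at h5 hw ⊢
          exact ⟨by linarith, by linarith⟩
        · simp [Mode.letter, h2]
        · simp [Mode.letter, h2, side, List.replicate_succ]
        · simp [Mode.Inv, h3, h4]
        · simp [Mode.letter, h1, side]
        · simp
        · simpa using fun h => absurd (Nat.le_of_dvd (by omega) h) (by omega)
  | dead =>
    exact ⟨rfl, fun A B hw => h.2 A B (follows_append.1 hw).1⟩
  | run e m s =>
    obtain ⟨u, v, rest, h, -⟩ := h
    simp only at h
    have hl := h.length
    cases e with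
    | true =>
      obtain ⟨rfl, hc⟩ := h.event rfl
      by_cases hx : x = m.letter
      · refine .of_transition (if_pos hx) ?_
        exact ⟨rfl, fun A B => h.not_follows (by simp [hx]) A B⟩
      · have hx' : x = !m.letter := Bool.eq_not.2 hx
        refine .of_transition (if_neg hx) ?_
        subst hx'
        refine ⟨u, v, _, h.letter ?_ ?_ ?_ ?_ ?_, ?_⟩
        · simp [Mode.timer]
        · simp [Mode.clock]
        · simp [ZigzagOp.apply, h.written_ahead]
        · simp [ZigzagOp.apply, hc]
        · simp [ZigzagOp.apply, hc]
        · have ht := h.clocks.tick (by simp at hl ⊢; omega)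
          cases hm : m.letter with
          | false => simpa [hm] using ht.2.2 hm
          | true =>
            have : (w ++ [false]).length = u.length + 2 := by
              simp [hm, side] at hl ⊢
              omega
            simp [this]
    | false =>
      obtain ⟨hf, hr, hr'⟩ := h.pass rfl
      cases rest with
      | cons y rest =>
        have hd : (tp (.inl m.letter)).2.head? = some y := by rw [hr]; rfl
        by_cases hx : x = y
        · subst hx
          refine .of_transition (by simp only [pairTransition, hd, if_true]; rfl) ?_
          refine ⟨u, v, _, h.letter ?_ ?_ ?_ ?_ ?_, ?_⟩
          · simp [Mode.timer]
          · simp [Mode.clock]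
          · simp [ZigzagOp.apply, h.written_ahead]
          · simp [ZigzagOp.apply, hr]
          · simp [ZigzagOp.apply, ← hr']
          · have ht := h.clocks.tick (by simp at hl ⊢; omega)
            cases hm : m.letter with
            | false => simpa [hm] using ht.2.2 hm
            | true =>
              have h1 := congrArg List.length hr'
              have h2 := h.clocks.lt hm
              simp [hm, side] at hl h1
              simpa [ht.2.1 hm] using not_dvd_of_lt (l := u.length + 2)
                (r := v.length - rest.length) (N := w.length + 1) (by omega) (by omega) (by omega)
        · refine .of_transition (by simp only [pairTransition, hd, if_neg hx]; rfl) ?_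
          exact ⟨rfl, fun A B => h.not_follows hx A B⟩
      | nil =>
        have hd : (tp (.inl m.letter)).2.head? = none := by rw [hr]; rfl
        have hN : w.length + (0 + 1) + 1 = u.length + 2 + (v.length + 2) := by simp at hl; omega
        have ht := Mode.Inv.tick (e := 0) h.clocks hN
        have hd' : ¬ (mediant u v).length + 2 ∣ (w ++ [true]).length := by
          intro hdvd
          have := Nat.le_of_dvd (by simp) hdvd
          rw [length_mediant] at this
          simp at this
          omega
        cases x with
        | true =>
          by_cases hm : m.letter = true
          · refine .of_transition (by simp only [pairTransition, hd, if_true, if_pos hm]; rfl) ?_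
            refine ⟨_, _, _, h.eventTrue rfl ?_ ?_ ?_, ?_⟩
            · simp [ZigzagOp.apply, h.words, side]
            · simp [ZigzagOp.apply, h.words, side]
            · have := ht.1.later (by rw [Mode.letter_tick, hm])
              simpa [Mode.timer, Mode.clock] using this
            · simpa using hd'
          · refine .of_transition (by simp only [pairTransition, hd, if_true, if_neg hm]; rfl) ?_
            refine ⟨_, _, _, h.eventTrue rfl ?_ ?_ ?_, ?_⟩
            · simp [ZigzagOp.apply, h.words, side]
            · simp [ZigzagOp.apply, h.words, side]
            · have := h.clocks.swap (by simpa using hm) hf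
              simpa [Mode.timer] using this
            · simpa using hd'
        | false =>
          refine .of_transition (by simp only [pairTransition, hd]; rfl) ?_
          refine ⟨_, _, _, h.eventFalse ?_ ?_ ?_ ?_, ?_⟩
          · cases (m.tick (tp (.inr s)).2.head? (tp (.inr !s)).2.head?).1 <;> rfl
          · simp [ZigzagOp.apply, h.words, side]
          · simp [ZigzagOp.apply, h.words, side]
          · have := ht.1.afterFalse (Mode.tick_ne_fresh _ _ _) (by omega)
            simpa [Mode.timer, Mode.clock] using this
          · cases hm : m.letter with
            | false => simpa using ht.2.2 hm
            | true =>
              have h2 := h.clocks.lt hm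
              simpa [ht.2.1 hm] using not_dvd_of_lt (l := u.length + 2)
                (r := v.length + 1) (N := w.length + 1) (by omega) (by omega) (by omega)

end

theorem mem_accepts_pairMachine (w : List Bool) : w ∈ pairMachine.accepts ↔ IsCuttingWord w := by
  have h : PairInv w (pairMachine.run w) := by
    induction w using List.reverseRecOn with
    | nil => exact ⟨rfl, rfl, fun _ => rfl⟩
    | append_singleton w x ih =>
      rw [ZigzagMachine.run_append_singleton, pairMachine_step]
      exact ih.step x
  change (pairMachine.run w).1.2 = true ↔ _
  generalize pairMachine.run w = c at h
  obtain ⟨⟨q, acc⟩, tp⟩ := c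
  cases q with
  | start =>
    obtain ⟨rfl, h, -⟩ := h
    exact iff_of_true h trivial
  | initial a =>
    obtain ⟨h, k, rfl, -⟩ := h
    refine iff_of_true h ?_
    cases a
    · simp [IsCuttingWord, follows_replicate_false, List.count_replicate, Below]
    · simp [IsCuttingWord, follows_replicate_true, List.count_replicate, Below]
  | dead =>
    obtain ⟨rfl, h⟩ := h
    exact iff_of_false Bool.false_ne_true (h _ _)
  | run e m s =>
    obtain ⟨u, v, rest, h, h'⟩ := h
    exact h'.trans h.isCuttingWord_iff.symm

end Cutting

namespace StraightLine

open Cutting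

variable {n : ℕ}

/-! ### The combing words -/

/-- The number of letters `aᵢ` and `aᵢ⁻¹` in `w`. -/
def cnt (w : List (Letter n)) (i : Fin n) : ℕ := (w.map Prod.fst).count i

theorem cnt_append (v w : List (Letter n)) (i : Fin n) : cnt (v ++ w) i = cnt v i + cnt w i := by
  simp [cnt]

theorem cnt_cons (x : Letter n) (w : List (Letter n)) (i : Fin n) :
    cnt (x :: w) i = cnt w i + if x.1 = i then 1 else 0 := by
  simp [cnt, List.count_cons]

/-- If the number of crossings of the `i`-th coordinate is `P i`, then the letters of `w` are
written in the order of their crossings: whenever a letter of index `i` is written, the next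
crossing of any other coordinate `j` takes place later, or at the same time and `j < i`. -/
def Ordered (P : Fin n → ℕ) (w : List (Letter n)) : Prop :=
  ∀ v x t, w = v ++ x :: t →
    (∀ j, x.1 < j → (cnt v x.1 + 1) * P j < (cnt v j + 1) * P x.1) ∧
    (∀ j, j < x.1 → (cnt v x.1 + 1) * P j ≤ (cnt v j + 1) * P x.1)

/-- A word is determined by the order of its letters, their numbers and their signs. -/
theorem Ordered.unique {P : Fin n → ℕ} {w w' : List (Letter n)} {σ : Fin n → Bool}
    (h : Ordered P w) (h' : Ordered P w') (hc : cnt w = cnt w') (hσ : ∀ x ∈ w, x.2 = σ x.1)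
    (hσ' : ∀ x ∈ w', x.2 = σ x.1) : w = w' := by
  suffices H : ∀ u u' v : List (Letter n), w = v ++ u → w' = v ++ u' → u = u' from
    H w w' [] rfl rfl
  intro u
  induction u with
  | nil =>
    intro u' v hw hw'
    cases u' with
    | nil => rfl
    | cons y u' =>
      have := congrFun hc y.1
      rw [hw, hw', cnt_append, cnt_append, cnt_cons] at this
      simp [cnt] at this
  | cons x u ih =>
    intro u' v hw hw'
    cases u' with
    | nil =>
      have := congrFun hc x.1
      rw [hw, hw', cnt_append, cnt_append, cnt_cons] at this
      simp [cnt] at this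
    | cons y u' =>
      have h1 := h v x u hw
      have h2 := h' v y u' hw'
      have hxy : x.1 = y.1 := by
        rcases lt_trichotomy x.1 y.1 with hlt | heq | hgt
        · exact absurd (h1.1 _ hlt) (not_lt.2 (h2.2 _ hlt))
        · exact heq
        · exact absurd (h2.1 _ hgt) (not_lt.2 (h1.2 _ hgt))
      obtain rfl : x = y := by
        refine Prod.ext hxy ?_
        rw [hσ x (by simp [hw]), hσ' y (by simp [hw']), hxy]
      rw [ih u' (v ++ [x]) (by simp [hw]) (by simp [hw'])]

/-- The index of a crossing. -/
def idx (e : ℝ ×ₗ (Fin n)ᵒᵈ) : Fin n := OrderDual.ofDual (ofLex e).2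

theorem mem_crossings (p : Fin n → ℤ) (e : ℝ ×ₗ (Fin n)ᵒᵈ) :
    e ∈ crossings p ↔ ∃ s < (p (idx e)).natAbs, (ofLex e).1 = (s + 1 : ℝ) / (p (idx e)).natAbs := by
  rw [crossings, Finset.mem_sort, Set.Finite.mem_toFinset]
  change 0 ≤ (ofLex e).1 ∧ (ofLex e).1 ≤ 1 ∧
    (∃ m : ℤ, m ≠ 0 ∧ (p (idx e) : ℝ) * (ofLex e).1 = m) ↔ _
  generalize (ofLex e).1 = t
  generalize p (idx e) = q
  have hq : (q.natAbs : ℝ) = |(q : ℝ)| := by rw [Nat.cast_natAbs, Int.cast_abs]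
  constructor
  · rintro ⟨h0, h1, m, hm, h⟩
    have hm' : 1 ≤ m.natAbs := by omega
    have hmq : (m.natAbs : ℝ) = q.natAbs * t := by
      rw [hq, Nat.cast_natAbs, Int.cast_abs, ← h, abs_mul, abs_of_nonneg h0]
    have hle : m.natAbs ≤ q.natAbs := by
      have : (m.natAbs : ℝ) ≤ q.natAbs := by
        rw [hmq]
        exact mul_le_of_le_one_right (Nat.cast_nonneg _) h1
      exact_mod_cast this
    have hq0 : (q.natAbs : ℝ) ≠ 0 := by
      have : q.natAbs ≠ 0 := by omega
      exact_mod_cast this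
    refine ⟨m.natAbs - 1, by omega, ?_⟩
    rw [Nat.cast_sub hm', hmq]
    field_simp
    simp
  · rintro ⟨s, hs, rfl⟩
    have hq0 : (0 : ℝ) < q.natAbs := by exact_mod_cast (by omega : 0 < q.natAbs)
    have hs' : (s + 1 : ℝ) ≤ q.natAbs := by exact_mod_cast hs
    refine ⟨by positivity, (div_le_one hq0).2 hs', ?_⟩
    rcases le_total 0 q with h | h
    · refine ⟨s + 1, by omega, ?_⟩
      rw [hq, abs_of_nonneg (by exact_mod_cast h)] at hq0 ⊢
      push_cast
      field_simp
    · refine ⟨-(s + 1), by omega, ?_⟩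
      rw [hq, abs_of_nonpos (by exact_mod_cast h)] at hq0 ⊢
      have : (q : ℝ) ≠ 0 := by linarith
      push_cast
      field_simp

theorem pairwise_crossings (p : Fin n → ℤ) : (crossings p).Pairwise (· < ·) :=
  (Finset.sortedLT_sort _).pairwise

/-- The crossings of one coordinate take place at regular intervals. -/
theorem filter_crossings (p : Fin n → ℤ) (i : Fin n) :
    (crossings p).filter (fun e => idx e = i) = (List.range (p i).natAbs).map fun s : ℕ =>
      (toLex ((s + 1 : ℝ) / (p i).natAbs, OrderDual.toDual i) : ℝ ×ₗ (Fin n)ᵒᵈ) := by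
  have h1 : ((crossings p).filter (fun e => idx e = i)).Pairwise (· < ·) :=
    (pairwise_crossings p).filter _
  have h2 : ((List.range (p i).natAbs).map fun s : ℕ =>
      (toLex ((s + 1 : ℝ) / (p i).natAbs, OrderDual.toDual i) : ℝ ×ₗ (Fin n)ᵒᵈ)).Pairwise
        (· < ·) := by
    rw [List.pairwise_map]
    refine List.Pairwise.imp_of_mem ?_ List.pairwise_lt_range
    intro a b ha _ hab
    rw [List.mem_range] at ha
    rw [Prod.Lex.toLex_lt_toLex]
    left
    have : (0 : ℝ) < (p i).natAbs := by exact_mod_cast (by omega : 0 < (p i).natAbs)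
    have : (a : ℝ) < b := by exact_mod_cast hab
    dsimp only
    gcongr
  refine List.Perm.eq_of_pairwise' h1 h2 ?_
  rw [List.perm_ext_iff_of_nodup (h1.imp ne_of_lt) (h2.imp ne_of_lt)]
  intro e
  simp only [List.mem_filter, mem_crossings, List.mem_map, List.mem_range, decide_eq_true_eq]
  constructor
  · rintro ⟨⟨s, hs, he⟩, rfl⟩
    exact ⟨s, hs, by rw [← he]; rfl⟩
  · rintro ⟨s, hs, rfl⟩
    exact ⟨⟨s, hs, rfl⟩, rfl⟩

theorem letter_fst (p : Fin n → ℤ) (t : ℝ) (i : Fin n) : (letter p t i).1 = i := by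
  rw [letter]
  split <;> rfl

theorem cnt_letters (p : Fin n → ℤ) (E : List (ℝ ×ₗ (Fin n)ᵒᵈ)) (i : Fin n) :
    cnt (E.map fun e => letter p (ofLex e).1 (OrderDual.ofDual (ofLex e).2)) i =
      (E.filter fun e => idx e = i).length := by
  rw [cnt, List.map_map, List.count, List.countP_map, List.countP_eq_length_filter]
  congr 2
  funext e
  simp [letter_fst]
  rfl

theorem cnt_word (p : Fin n → ℤ) (i : Fin n) : cnt (word p) i = (p i).natAbs := by
  rw [word, cnt_letters, filter_crossings]
  simp

theorem sign_word (p : Fin n → ℤ) (x : Letter n) (hx : x ∈ word p) :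
    x.2 = decide (0 < p x.1) := by
  rw [word, List.mem_map] at hx
  obtain ⟨e, he, rfl⟩ := hx
  obtain ⟨s, hs, ht⟩ := (mem_crossings p e).1 he
  change (letter p (ofLex e).1 (idx e)).2 = decide (0 < p (letter p (ofLex e).1 (idx e)).1)
  have : (0 : ℝ) < (ofLex e).1 := by
    rw [ht]
    have : (0 : ℝ) < (p (idx e)).natAbs := by exact_mod_cast (by omega : 0 < (p (idx e)).natAbs)
    positivity
  rw [letter]
  by_cases h : 0 < p (idx e)
  · have : 0 < (p (idx e) : ℝ) * (ofLex e).1 := mul_pos (by exact_mod_cast h) this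
    simp [this, h]
  · have : ¬ 0 < (p (idx e) : ℝ) * (ofLex e).1 := by
      rw [mul_pos_iff_of_pos_right this]
      exact_mod_cast h
    simp [this, h]

/-- If `k` crossings of the `i`-th coordinate precede a place in the list of crossings and more
are to follow, then the next one takes place at the time `(k + 1) / |pᵢ|`. -/
theorem head_filter_crossings {p : Fin n → ℤ} {E E' : List (ℝ ×ₗ (Fin n)ᵒᵈ)}
    (h : crossings p = E ++ E') (i : Fin n) :
    (E'.filter fun e => idx e = i).head? =
      if (E.filter fun e => idx e = i).length < (p i).natAbs then
        some (toLex (((E.filter fun e => idx e = i).length + 1 : ℝ) / (p i).natAbs,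
          OrderDual.toDual i) : ℝ ×ₗ (Fin n)ᵒᵈ)
      else none := by
  have h1 := filter_crossings p i
  rw [h, List.filter_append] at h1
  have h2 := congrArg (·[(E.filter fun e => idx e = i).length]?) h1
  simp only [List.getElem?_append_right le_rfl, Nat.sub_self, List.getElem?_map] at h2
  rw [List.head?_eq_getElem?, h2]
  split_ifs with hlt
  · rw [List.getElem?_range hlt]
    rfl
  · rw [List.getElem?_eq_none (by simpa using hlt)]
    rfl

theorem ordered_word (p : Fin n → ℤ) : Ordered (fun i => (p i).natAbs) (word p) := by
  intro v x t hw
  obtain ⟨E, E', hE, rfl, hE'⟩ := List.map_eq_append_iff.1 hw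
  obtain ⟨e, E', rfl, rfl, rfl⟩ := List.map_eq_cons_iff.1 hE'
  have hpw := (List.pairwise_append.1 (hE ▸ pairwise_crossings p)).2.1
  simp only [letter_fst, cnt_letters]
  change (∀ j, idx e < j → ((E.filter fun e' => idx e' = idx e).length + 1) * (p j).natAbs <
      ((E.filter fun e' => idx e' = j).length + 1) * (p (idx e)).natAbs) ∧
    (∀ j, j < idx e → ((E.filter fun e' => idx e' = idx e).length + 1) * (p j).natAbs ≤
      ((E.filter fun e' => idx e' = j).length + 1) * (p (idx e)).natAbs)
  have hi := head_filter_crossings hE (idx e)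
  generalize (E.filter fun e' => idx e' = idx e).length = c at hi ⊢
  simp only [List.filter_cons, decide_true, if_true, List.head?_cons] at hi
  split_ifs at hi with hc
  have time : (ofLex e).1 = (c + 1 : ℝ) / (p (idx e)).natAbs :=
    congrArg (fun e => (ofLex e).1) (Option.some.inj hi)
  have hP : (0 : ℝ) < (p (idx e)).natAbs := by
    exact_mod_cast (by omega : 0 < (p (idx e)).natAbs)
  -- the next crossing of the coordinate `j`, if there is one, comes after `e`
  have key : ∀ j, j ≠ idx e → (E.filter fun e' => idx e' = j).length < (p j).natAbs →
      e < toLex (((E.filter fun e' => idx e' = j).length + 1 : ℝ) / (p j).natAbs,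
        OrderDual.toDual j) := by
    intro j hj hlt
    have h := head_filter_crossings hE j
    rw [if_pos hlt, List.filter_cons_of_neg (by simpa using hj.symm)] at h
    exact (List.pairwise_cons.1 hpw).1 _ (List.mem_filter.1 (List.mem_of_head? h)).1
  have last : ∀ j, ¬ (E.filter fun e' => idx e' = j).length < (p j).natAbs →
      (c + 1) * (p j).natAbs <
        ((E.filter fun e' => idx e' = j).length + 1) * (p (idx e)).natAbs := by
    intro j h
    calc (c + 1) * (p j).natAbs ≤ (p (idx e)).natAbs * (p j).natAbs := by gcongr; omega
      _ = (p j).natAbs * (p (idx e)).natAbs := mul_comm _ _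
      _ < _ := by gcongr <;> omega
  constructor
  · intro j hj
    by_cases h : (E.filter fun e' => idx e' = j).length < (p j).natAbs
    · rcases Prod.Lex.lt_iff.1 (key j hj.ne' h) with hlt | ⟨-, hlt⟩
      · have hPj : (0 : ℝ) < (p j).natAbs := by exact_mod_cast (by omega : 0 < (p j).natAbs)
        rw [time] at hlt
        exact_mod_cast (div_lt_div_iff₀ hP hPj).1 hlt
      · exact absurd (show j < idx e from hlt) hj.asymm
    · exact last j h
  · intro j hj
    by_cases h : (E.filter fun e' => idx e' = j).length < (p j).natAbs
    · have hle : (ofLex e).1 ≤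
          ((E.filter fun e' => idx e' = j).length + 1 : ℝ) / (p j).natAbs := by
        rcases Prod.Lex.lt_iff.1 (key j hj.ne h) with hlt | ⟨heq, -⟩
        · exact hlt.le
        · exact heq.le
      have hPj : (0 : ℝ) < (p j).natAbs := by exact_mod_cast (by omega : 0 < (p j).natAbs)
      rw [time] at hle
      exact_mod_cast (div_le_div_iff₀ hP hPj).1 hle
    · exact (last j h).le

/-! ### Projections to two coordinates -/

/-- The projection to the coordinates `i` and `j`, which forgets the signs. -/
def proj (i j : Fin n) (x : Letter n) : Option Bool :=
  if x.1 = i then some false else if x.1 = j then some true else none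

theorem forall_append_singleton {α : Type} {Q : List α → α → Prop} (w : List α) (y : α) :
    (∀ v x t, w ++ [y] = v ++ x :: t → Q v x) ↔ (∀ v x t, w = v ++ x :: t → Q v x) ∧ Q w y := by
  constructor
  · exact fun h => ⟨fun v x t hw => h v x (t ++ [y]) (by simp [hw]), h w y [] rfl⟩
  · rintro ⟨h1, h2⟩ v x t hw
    rcases List.eq_nil_or_concat t with rfl | ⟨t, z, rfl⟩
    · obtain ⟨rfl, h⟩ := List.append_inj' hw rfl
      obtain rfl : y = x := by simpa using h
      exact h2
    · rw [List.concat_eq_append, ← List.cons_append, ← List.append_assoc] at hw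
      exact h1 v x t (List.append_inj' hw rfl).1

theorem count_filterMap_proj {i j : Fin n} (hij : i ≠ j) (w : List (Letter n)) :
    (w.filterMap (proj i j)).count false = cnt w i ∧
      (w.filterMap (proj i j)).count true = cnt w j := by
  induction w with
  | nil => simp [cnt]
  | cons x w ih =>
    rw [cnt_cons, cnt_cons, ← ih.1, ← ih.2, List.filterMap_cons]
    by_cases hi : x.1 = i
    · have hj : x.1 ≠ j := by rwa [hi]
      simp [proj, hi, hij]
    · by_cases hj : x.1 = j
      · simp [proj, hj, hij.symm]
      · simp [proj, hi, hj]

theorem follows_filterMap_proj {i j : Fin n} (hij : i ≠ j) (P : ℕ → ℕ → Prop)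
    (w : List (Letter n)) :
    Follows P 1 1 (w.filterMap (proj i j)) ↔ ∀ v x t, w = v ++ x :: t →
      (x.1 = i → ¬ P (cnt v i + 1) (cnt v j + 1)) ∧ (x.1 = j → P (cnt v i + 1) (cnt v j + 1)) := by
  induction w using List.reverseRecOn with
  | nil => simp [Follows]
  | append_singleton w x ih =>
    rw [forall_append_singleton (Q := fun v x => (x.1 = i → ¬ P (cnt v i + 1) (cnt v j + 1)) ∧
      (x.1 = j → P (cnt v i + 1) (cnt v j + 1))), List.filterMap_append, follows_append, ih,
      (count_filterMap_proj hij w).1, (count_filterMap_proj hij w).2, add_comm 1, add_comm 1]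
    refine and_congr_right fun _ => ?_
    rw [List.filterMap_cons]
    by_cases hi : x.1 = i
    · simp [proj, hi, hij, Follows]
    · by_cases hj : x.1 = j
      · simp [proj, hj, hij.symm, Follows]
      · simp [proj, hi, hj, Follows]

theorem ordered_iff (w : List (Letter n)) :
    Ordered (cnt w) w ↔ ∀ i j, i < j → IsCuttingWord (w.filterMap (proj i j)) := by
  have h : ∀ i j, i < j → (IsCuttingWord (w.filterMap (proj i j)) ↔ ∀ v x t, w = v ++ x :: t →
      (x.1 = i → (cnt v i + 1) * cnt w j < (cnt v j + 1) * cnt w i) ∧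
      (x.1 = j → (cnt v j + 1) * cnt w i ≤ (cnt v i + 1) * cnt w j)) := by
    intro i j hij
    rw [IsCuttingWord, follows_filterMap_proj hij.ne, (count_filterMap_proj hij.ne w).1,
      (count_filterMap_proj hij.ne w).2]
    simp only [Below, not_le]
  constructor
  · intro ho i j hij
    rw [h i j hij]
    intro v x t hw
    have := ho v x t hw
    exact ⟨by rintro rfl; exact this.1 j hij, by rintro rfl; exact this.2 i hij⟩
  · intro hc v x t hw
    exact ⟨fun j hj => ((h _ _ hj).1 (hc _ _ hj) v x t hw).1 rfl,
      fun j hj => ((h _ _ hj).1 (hc _ _ hj) v x t hw).2 rfl⟩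

theorem mem_combing_iff (w : List (Letter n)) :
    w ∈ combing n ↔ (∀ i, ¬ ((i, true) ∈ w ∧ (i, false) ∈ w)) ∧
      ∀ i j, i < j → IsCuttingWord (w.filterMap (proj i j)) := by
  rw [← ordered_iff]
  constructor
  · rintro ⟨p, rfl⟩
    refine ⟨fun i hi => ?_, ?_⟩
    · have h1 := sign_word p _ hi.1
      have h2 := sign_word p _ hi.2
      exact Bool.false_ne_true (h2.trans h1.symm)
    · rw [funext (cnt_word p)]
      exact ordered_word p
  · rintro ⟨h1, h2⟩
    let p : Fin n → ℤ := fun i => if (i, true) ∈ w then (cnt w i : ℤ) else -cnt w i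
    have hp : ∀ i, (p i).natAbs = cnt w i := by
      intro i
      simp only [p]
      split_ifs <;> simp
    refine ⟨p, h2.unique (σ := fun i => decide (0 < p i)) ?_ ?_ ?_ (sign_word p)⟩
    · rw [← funext hp]
      exact ordered_word p
    · rw [funext (cnt_word p), funext hp]
    · rintro ⟨i, b⟩ hx
      have hc : 0 < cnt w i := by
        rw [cnt, List.count_pos_iff]
        exact List.mem_map_of_mem hx
      cases b with
      | true => simp [p, hx, hc]
      | false =>
        have : (i, true) ∉ w := fun h => h1 i ⟨h, hx⟩
        simp [p, this]

/-- The machine without tapes that checks that `aᵢ` and `aᵢ⁻¹` do not both occur. -/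
def signMachine (i : Fin n) : ZigzagMachine (Letter n) where
  State := Bool × Bool
  Tape := Empty
  start := (false, false)
  accept := {s | ¬ (s.1 = true ∧ s.2 = true)}
  transition s x _ := ((s.1 || x = (i, true), s.2 || x = (i, false)), Empty.elim)

theorem mem_accepts_signMachine (i : Fin n) (w : List (Letter n)) :
    w ∈ (signMachine i).accepts ↔ ¬ ((i, true) ∈ w ∧ (i, false) ∈ w) := by
  have h : ((signMachine i).run w).1 = (decide ((i, true) ∈ w), decide ((i, false) ∈ w)) := by
    induction w using List.reverseRecOn with
    | nil => rfl
    | append_singleton w x ih =>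
      rw [ZigzagMachine.run_append_singleton]
      change (((signMachine i).run w).1.1 || decide (x = (i, true)),
        ((signMachine i).run w).1.2 || decide (x = (i, false))) = _
      rw [ih]
      simp [Bool.decide_or, eq_comm]
  change ¬ (((signMachine i).run w).1.1 = true ∧ ((signMachine i).run w).1.2 = true) ↔ _
  rw [h]
  simp

end StraightLine

theorem mainTheorem4 (n : ℕ) (hn : 1 ≤ n) :
    IsRealTimeLanguage (StraightLine.combing n) := by
  have h := (ZigzagMachine.inter (Sum.elim StraightLine.signMachine
    fun q : {q : Fin n × Fin n // q.1 < q.2} =>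
      (Cutting.pairMachine.comap (StraightLine.proj q.1.1 q.1.2)))).isRealTimeLanguage
  convert h using 1
  ext w
  rw [StraightLine.mem_combing_iff, ZigzagMachine.mem_accepts_inter]
  simp [StraightLine.mem_accepts_signMachine, ZigzagMachine.mem_accepts_comap,
    Cutting.mem_accepts_pairMachine]
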